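/- **Conventions.** Partitions have arbitrary size; $\ell(\lambda)$ is the number of parts of $\lambda$, $\lambda'$ its conjugate, and $m_i(\lambda')=\lambda_i-\lambda_{i+1}$ the number of columns of length $i$ in its Young diagram. Write $(a;q)_k=\prod_{i=0}^{k-1}(1-aq^i)$ and $\binom{m}{k}_q$ for the Gaussian binomial coefficient. The partition function of a finite rectangular lattice with prescribed boundary labels is the sum, over all labellings of the edges by non-negative integers compatible with the boundary, of the product of the vertex weights; the weight of a vertex depends on its bottom, left, top and right labels $a,b,c,d$, in this order. *$q$-Whittaker polynomials.* $W_\lambda(x_1,\dots,x_n)$ is given by the branching rule: in $0$ variables $W_\varnothing=1$ and $W_\lambda=0$ for $\lambda\neq\varnothing$, and $$W_\lambda(x_1,\dots,x_{n+1})=\sum_{\mu}x_{n+1}^{|\lambda|-|\mu|}\prod_{i\ge1}\binom{\lambda_i-\lambda_{i+1}}{\lambda_i-\mu_i}_q\,W_\mu(x_1,\dots,x_n),$$ where $\mu$ runs over the partitions with $\lambda_1\ge\mu_1\ge\lambda_2\ge\mu_2\ge\cdots$. *Inhomogeneous $q$-Whittaker polynomials.* $\mathbb F_\lambda(x_1,\dots,x_n)$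 is the partition function of the lattice with $n$ rows, carrying the parameters $x_n,\dots,x_1$ from bottom to top, with bottom labels $\dots,m_2(\lambda'),m_1(\lambda')$ from left to right, with left and top labels all $0$ and right labels free, where a vertex in a row with parameter $x$ has weight $$\mathbf 1_{a+b=c+d}\,\mathbf 1_{b\le c}\;x^{d}\,(x;q)_{c-b}\binom{a}{c-b}_q .$$ (Only the $\ell(\lambda)$ rightmost columns matter.) **Corollary.** Let $n$ be a positive integer and let $\lambda$ be a partition with $\ell(\lambda)\le n$. For a partition $\mu$ with $\ell(\mu)\le n$ let $b_{\lambda,\mu}(q)\in\mathbb Z[q]$ be the partition function of the $n\times n$ lattice with bottom labels $m_n(\lambda'),\dots,m_1(\lambda')$ from left to right, right labels $m_1(\mu'),\dots,m_n(\mu')$ from bottom to top, left and top labels all $0$, and vertex weights $$\mathbf 1_{a+b=c+d}\,\mathbf 1_{b\le c}\,(-1)^{c-b}q^{\binom{c-b}{2}}\binom{a}{c-b}_q .$$ Then only finitely many of the $b_{\lambda,\mu}(q)$ are nonzero, $$\mathbb F_\lambda(x_1,\dots,x_n)=\sum_{\mu:\ \ell(\mu)\le n}b_{\lambda,\mu}(q)\,W_\mu(x_1,\dots,x_n),$$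 and $(-1)^{|\lambda|-|\mu|}\,b_{\lambda,\mu}(q)\in\mathbb N[q]$ for every partition $\mu$ with $\ell(\mu)\le n$. -/

import Mathlib

/-- The Gaussian binomial coefficient `[n choose k]_q`, by the `q`-Pascal recursion. -/
def qBinom {R : Type*} [CommRing R] (q : R) : ℕ → ℕ → R
  | _, 0 => 1
  | 0, _ + 1 => 0
  | n + 1, k + 1 => qBinom q n k + q ^ (k + 1) * qBinom q n (k + 1)

/-- The `q`-Pochhammer symbol `(a; q)_k = (1 - a) (1 - a q) ⋯ (1 - a q^(k-1))`. -/
def qPochhammer {R : Type*} [CommRing R] (a q : R) (k : ℕ) : R :=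
  ∏ i ∈ Finset.range k, (1 - a * q ^ i)

theorem qBinom_eq_zero {R : Type*} [CommRing R] (q : R) :
    ∀ n k : ℕ, n < k → qBinom q n k = 0
  | _, 0, h => absurd h (Nat.not_lt_zero _)
  | 0, _ + 1, _ => rfl
  | n + 1, k + 1, h => by
      rw [qBinom, qBinom_eq_zero q n k (by omega), qBinom_eq_zero q n (k + 1) (by omega)]
      ring

/-- The recursion gives the usual quotient
`[m + k choose k]_q = (q; q)_(m+k) / ((q; q)_k (q; q)_m)`. -/
theorem qBinom_mul_qPochhammer {R : Type*} [CommRing R] (q : R) (m k : ℕ) :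
    qBinom q (m + k) k * (qPochhammer q q k * qPochhammer q q m) = qPochhammer q q (m + k) := by
  have hs : ∀ j, qPochhammer q q (j + 1) = qPochhammer q q j * (1 - q * q ^ j) := fun j => by
    rw [qPochhammer, Finset.prod_range_succ, ← qPochhammer]
  induction k generalizing m with
  | zero => cases m <;> simp [qBinom, qPochhammer]
  | succ k ihk =>
    induction m with
    | zero =>
      have h := ihk 0
      have h0 : qPochhammer q q 0 = 1 := by simp [qPochhammer]
      simp only [h0, Nat.zero_add, mul_one] at h ⊢
      rw [qBinom, qBinom_eq_zero q k (k + 1) (by omega), hs k, ← mul_assoc, mul_zero, add_zero, h]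
    | succ m ihm =>
      have h1 := ihk (m + 1)
      rw [show m + (k + 1) = m + k + 1 by omega] at ihm
      rw [show m + 1 + k = m + k + 1 by omega] at h1
      rw [show m + 1 + (k + 1) = m + k + 1 + 1 by omega, qBinom, hs (m + k + 1)]
      rw [hs k] at ihm ⊢
      rw [hs m] at h1 ⊢
      linear_combination (1 - q * q ^ k) * h1 + q ^ (k + 1) * (1 - q * q ^ m) * ihm

/-- The partition function of a rectangular lattice with `r` rows (numbered from bottom to top) and
`c` columns (numbered from left to right). A configuration labels every edge by a natural number:
`s.1 i j` is the label of the `i`-th vertical edge of column `j` (`i = 0` at the bottom, `i = r` at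
the top) and `s.2 i j` is the label of the `j`-th horizontal edge of row `i` (`j = 0` at the left,
`j = c` at the right). The bottom, top and left boundary labels are prescribed, and the tuple of
right boundary labels has to belong to the set `right`. The weight of a configuration is the product
of the weights `w i j bottom left top right` of its vertices, and the partition function is the sum
of the weights of all configurations. -/
noncomputable def latticePartitionFunction {R : Type*} [CommRing R] {r c : ℕ}
    (w : Fin r → Fin c → ℕ → ℕ → ℕ → ℕ → R)
    (bottom top : Fin c → ℕ) (left : Fin r → ℕ) (right : Set (Fin r → ℕ)) : R :=
  ∑ᶠ s ∈ {s : (Fin (r + 1) → Fin c → ℕ) × (Fin r → Fin (c + 1) → ℕ) |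
      s.1 0 = bottom ∧ s.1 (Fin.last r) = top ∧
      (fun i => s.2 i 0) = left ∧ (fun i => s.2 i (Fin.last c)) ∈ right},
    ∏ i : Fin r, ∏ j : Fin c,
      w i j (s.1 i.castSucc j) (s.2 i j.castSucc) (s.1 i.succ j) (s.2 i j.succ)

/-- If the vertex weights conserve the number of particles, only finitely many configurations
contribute to the partition function. -/
theorem latticePartitionFunction_finite {R : Type*} [CommRing R] {r c : ℕ}
    (w : Fin r → Fin c → ℕ → ℕ → ℕ → ℕ → R)
    (hw : ∀ i j a b c' d, w i j a b c' d ≠ 0 → a + b = c' + d)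
    (bottom : Fin c → ℕ) (left : Fin r → ℕ) :
    {s : (Fin (r + 1) → Fin c → ℕ) × (Fin r → Fin (c + 1) → ℕ) |
      s.1 0 = bottom ∧ (fun i => s.2 i 0) = left ∧
      ∏ i : Fin r, ∏ j : Fin c,
        w i j (s.1 i.castSucc j) (s.2 i j.castSucc) (s.1 i.succ j) (s.2 i j.succ) ≠ 0}.Finite := by
  classical
  set M : ℕ := ∑ j, bottom j + ∑ i, left i with hM
  refine (Set.finite_Icc (0 : (Fin (r + 1) → Fin c → ℕ) × (Fin r → Fin (c + 1) → ℕ))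
    (fun i _ => (c + 2) ^ (i : ℕ) * M, fun i j => (c + 2) ^ (i : ℕ) * M * (j + 1))).subset ?_
  rintro ⟨V, H⟩ ⟨hb, hl, hp⟩
  dsimp only at hb hl hp
  have hcons : ∀ i j, V i.castSucc j + H i j.castSucc = V i.succ j + H i j.succ := by
    intro i j
    refine hw i j _ _ _ _ fun h0 => hp ?_
    exact Finset.prod_eq_zero (Finset.mem_univ i) (Finset.prod_eq_zero (Finset.mem_univ j) h0)
  have hH0 : ∀ i, H i 0 ≤ M := by
    intro i
    have h1 : H i 0 = left i := congrFun hl i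
    have h2 := Finset.single_le_sum (f := left) (fun _ _ => Nat.zero_le _) (Finset.mem_univ i)
    omega
  have hrow : ∀ (i : Fin r), (∀ j, V i.castSucc j ≤ (c + 2) ^ (i : ℕ) * M) →
      ∀ j : Fin (c + 1), H i j ≤ (c + 2) ^ (i : ℕ) * M * (j + 1) := by
    intro i hV j
    induction j using Fin.induction with
    | zero =>
      have h1 : 1 * M ≤ (c + 2) ^ (i : ℕ) * M := Nat.mul_le_mul_right M (Nat.one_le_pow _ _ (by omega))
      have h2 := hH0 i
      simpa using by omega
    | succ j ih =>
      have h1 := hcons i j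
      have h2 := hV j
      simp only [Fin.val_castSucc, Fin.val_succ] at ih ⊢
      nlinarith
  have hVb : ∀ (i : Fin (r + 1)) j, V i j ≤ (c + 2) ^ (i : ℕ) * M := by
    intro i
    induction i using Fin.induction with
    | zero =>
      intro j
      have h1 : V 0 j = bottom j := congrFun hb j
      have h2 := Finset.single_le_sum (f := bottom) (fun _ _ => Nat.zero_le _) (Finset.mem_univ j)
      simpa using by omega
    | succ i ih =>
      intro j
      have h1 := hcons i j
      have h2 := ih j
      have h3 := hrow i ih j.castSucc
      have h4 : (j : ℕ) < c := j.2
      simp only [Fin.val_castSucc, Fin.val_succ, pow_succ] at h2 h3 ⊢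
      have h5 : (c + 2) ^ (i : ℕ) * M * ((j : ℕ) + 1) ≤ (c + 2) ^ (i : ℕ) * M * (c + 1) :=
        Nat.mul_le_mul_left _ (by omega)
      nlinarith
  refine ⟨⟨fun _ _ => Nat.zero_le _, fun _ _ => Nat.zero_le _⟩, ⟨fun i j => hVb i j, fun i j => ?_⟩⟩
  exact hrow i (fun j => hVb i.castSucc j) j

namespace YoungDiagram

/-- `m_i(λ')`: the number of columns of length `i` of the diagram of `λ`, that is, the multiplicity
of `i` as a part of the conjugate partition `λ'`. -/
def colMult (lam : YoungDiagram) (i : ℕ) : ℕ :=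
  lam.transpose.rowLens.count i

end YoungDiagram

/-- The weight `1_{a+b=c+d} 1_{b≤c} x^d (u x; q)_{c-b} [a choose c-b]_q` of a vertex with bottom,
left, top and right labels `a`, `b`, `c`, `d`, horizontal parameter `x` and vertical parameter
`(u, 0)`. -/
def inhomWeight {R : Type*} [CommRing R] (q u x : R) (a b c d : ℕ) : R :=
  if a + b = c + d ∧ b ≤ c then x ^ d * qPochhammer (u * x) q (c - b) * qBinom q a (c - b) else 0

/-- The inhomogeneous `q`-Whittaker polynomial `𝔽_λ(x_1, …, x_n)`: all vertical parameters are
`(u, v) = (1, 0)`, the rows carry `x_n, …, x_1` from bottom to top, the columns have bottom labels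
`…, m_2(λ'), m_1(λ')` from left to right, the left and top labels vanish, and the right labels are
free. Columns to the left of the first `ℓ(λ)` ones receive no particles and have weight `1`, so they
are left out. Here `x_1, …, x_n` are `X 0, …, X (n - 1)`. -/
noncomputable def inhomQWhittaker (n : ℕ) (lam : YoungDiagram) :
    MvPolynomial (Fin n) (Polynomial ℤ) :=
  latticePartitionFunction (r := n) (c := lam.colLen 0)
    (fun i _ => inhomWeight (MvPolynomial.C Polynomial.X) 1 (MvPolynomial.X i.rev))
    (fun j => lam.colMult ((j.rev : ℕ) + 1)) (fun _ => 0) (fun _ => 0) Set.univ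

/-- The `q`-Whittaker polynomial `W_λ(x_1, …, x_n)`, by its branching rule: `W_λ()` is `1` if `λ` is
empty and `0` otherwise, and `W_λ(x_1, …, x_{n+1})` is the sum over all `μ` interlacing with `λ`
(`λ_1 ≥ μ_1 ≥ λ_2 ≥ μ_2 ≥ ⋯`) of
`x_{n+1}^{|λ|-|μ|} ∏_i [λ_i - λ_{i+1} choose λ_i - μ_i]_q W_μ(x_1, …, x_n)`.
All factors with `i > ℓ(λ)` are equal to `1`. -/
noncomputable def qWhittaker : (n : ℕ) → YoungDiagram → MvPolynomial (Fin n) (Polynomial ℤ)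
  | 0, lam => open Classical in if lam = ⊥ then 1 else 0
  | n + 1, lam =>
    ∑ᶠ mu ∈ {mu : YoungDiagram |
        ∀ i, mu.rowLen i ≤ lam.rowLen i ∧ lam.rowLen (i + 1) ≤ mu.rowLen i},
      MvPolynomial.X (Fin.last n) ^ (lam.card - mu.card) *
        MvPolynomial.C (∏ i ∈ Finset.range (lam.colLen 0),
          qBinom (Polynomial.X : Polynomial ℤ)
            (lam.rowLen i - lam.rowLen (i + 1)) (lam.rowLen i - mu.rowLen i)) *
        MvPolynomial.rename Fin.castSucc (qWhittaker n mu)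

/-- The weight `1_{a+b=c+d} 1_{b≤c} (-1)^{c-b} q^{binom(c-b,2)} [a choose c-b]_q` of a vertex with
bottom, left, top and right labels `a`, `b`, `c`, `d`. -/
def expansionWeight {R : Type*} [CommRing R] (q : R) (a b c d : ℕ) : R :=
  if a + b = c + d ∧ b ≤ c then
    (-1) ^ (c - b) * q ^ (c - b).choose 2 * qBinom q a (c - b) else 0

/-- `b_{λ,μ}(q)`: the partition function of the `n × n` lattice with bottom labels
`m_n(λ'), …, m_1(λ')` from left to right, right labels `m_1(μ'), …, m_n(μ')` from bottom to top, and
left and top labels `0`. -/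
noncomputable def expansionCoeff (n : ℕ) (lam mu : YoungDiagram) : Polynomial ℤ :=
  latticePartitionFunction (r := n) (c := n)
    (fun _ _ => expansionWeight (Polynomial.X : Polynomial ℤ))
    (fun j => lam.colMult ((j.rev : ℕ) + 1)) (fun _ => 0) (fun _ => 0)
    {fun i : Fin n => mu.colMult ((i : ℕ) + 1)}

/-! The expansion lattice intertwines two transfer operators. A row with vertical parameter `u = 1`
adds a variable to `𝔽`; the vertices with `u = 0`, whose Pochhammer factor is `1`, give the
branching rule of `W` in terms of column multiplicities. In an `n × n` lattice with empty left and
top boundary only a triangle of vertices is active, so `b` becomes the operator `triangleOp`. The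
key relation, `triangleOp_branchOp`, says that a `u = 1` row followed by the triangle of size `n`
equals the triangle of size `n + 1` followed by a branching step. Iterating it over the variables
gives `inhomRec_eq_triangleOp`, which is the expansion.

The intertwining rests on two local identities. `vertex_factorization` splits a `u = 1` vertex at
the corner into an expansion vertex and a `u = 0` vertex; `vertex_yang_baxter`, extended to rows,
carries the `u = 0` vertex through the remaining columns. Both reduce to the `q`-binomial theorem,
trinomial revision and `q`-Vandermonde.

Finiteness is particle conservation: the labels of `μ` have the same sum as those of `λ`. For the
sign, edges receive integer heights for which a vertex raises the total weighted label by exactly `c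
- b`, the exponent of `-1` in its weight. The boundary totals are `|λ|` and `|μ|`, so every
configuration carries the sign `(-1)^(|μ| - |λ|)`, and the other factors lie in `ℕ[q]`. -/

open Finset.HasAntidiagonal (antidiagonal)

/-! ### Gaussian binomial identities -/

section QBinomial

variable {R : Type*} [CommRing R]

theorem qBinom_zero_right (q : R) (n : ℕ) : qBinom q n 0 = 1 := by cases n <;> rfl

theorem qBinom_succ_succ (q : R) (n k : ℕ) :
    qBinom q (n + 1) (k + 1) = qBinom q n k + q ^ (k + 1) * qBinom q n (k + 1) := rfl

theorem qBinom_self (q : R) (n : ℕ) : qBinom q n n = 1 := by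
  induction n with
  | zero => rfl
  | succ n ih => rw [qBinom_succ_succ, ih, qBinom_eq_zero q n (n + 1) (by omega)]; ring

theorem map_qBinom {S : Type*} [CommRing S] (φ : R →+* S) (q : R) (n k : ℕ) :
    φ (qBinom q n k) = qBinom (φ q) n k := by
  induction n generalizing k with
  | zero => cases k <;> simp [qBinom]
  | succ n ih => cases k <;> simp [qBinom, ih]

theorem map_qPochhammer {S : Type*} [CommRing S] (φ : R →+* S) (a q : R) (k : ℕ) :
    φ (qPochhammer a q k) = qPochhammer (φ a) (φ q) k := by
  simp [qPochhammer, map_prod]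

theorem qPochhammer_zero_right (a q : R) : qPochhammer a q 0 = 1 := by simp [qPochhammer]

theorem qPochhammer_zero_left (q : R) (k : ℕ) : qPochhammer 0 q k = 1 := by simp [qPochhammer]

theorem qPochhammer_add (a q : R) (m n : ℕ) :
    qPochhammer a q (m + n) = qPochhammer a q m * qPochhammer (a * q ^ m) q n := by
  simp only [qPochhammer, Finset.prod_range_add, pow_add, mul_assoc]

theorem qPochhammer_X_ne_zero (k : ℕ) :
    qPochhammer (Polynomial.X : Polynomial ℤ) Polynomial.X k ≠ 0 := by
  refine Finset.prod_ne_zero_iff.2 fun i _ h => ?_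
  have := congrArg (Polynomial.eval 0) h
  simp at this

/-- Trinomial revision for Gaussian binomial coefficients. -/
theorem qBinom_mul_qBinom (q : R) (a k t : ℕ) :
    qBinom q a k * qBinom q (a - k) t = qBinom q a (k + t) * qBinom q (k + t) k := by
  rcases lt_or_ge a (k + t) with h | h
  · rw [qBinom_eq_zero q a (k + t) h]
    rcases lt_or_ge a k with h' | h'
    · rw [qBinom_eq_zero q a k h']; ring
    · rw [qBinom_eq_zero q (a - k) t (by omega)]; ring
  obtain ⟨m, rfl⟩ := Nat.exists_eq_add_of_le' h
  rw [show m + (k + t) - k = m + t by omega]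
  -- In `ℤ[X]` the factors `(X; X)_k` are nonzero and can be cancelled; the identity then
  -- specialises to any `q`.
  have key : qBinom (Polynomial.X : Polynomial ℤ) (m + (k + t)) k * qBinom Polynomial.X (m + t) t =
      qBinom Polynomial.X (m + (k + t)) (k + t) * qBinom Polynomial.X (k + t) k := by
    have h1 := qBinom_mul_qPochhammer (Polynomial.X : Polynomial ℤ) (m + t) k
    have h2 := qBinom_mul_qPochhammer (Polynomial.X : Polynomial ℤ) m t
    have h3 := qBinom_mul_qPochhammer (Polynomial.X : Polynomial ℤ) m (k + t)
    have h4 := qBinom_mul_qPochhammer (Polynomial.X : Polynomial ℤ) t k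
    rw [show m + t + k = m + (k + t) by omega] at h1
    rw [show t + k = k + t by omega] at h4
    have hk := qPochhammer_X_ne_zero k
    have ht := qPochhammer_X_ne_zero t
    have hm := qPochhammer_X_ne_zero m
    refine mul_right_cancel₀ (mul_ne_zero hk (mul_ne_zero ht hm)) ?_
    rw [← h2] at h1
    rw [← h4] at h3
    linear_combination h1 - h3
  have := congrArg (Polynomial.eval₂RingHom (Int.castRingHom R) q) key
  simp only [map_mul, map_qBinom] at this
  simpa using this

theorem qBinom_symm_add (q : R) (k t : ℕ) : qBinom q (k + t) k = qBinom q (k + t) t := by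
  have key : qBinom (Polynomial.X : Polynomial ℤ) (k + t) k = qBinom Polynomial.X (k + t) t := by
    have h1 := qBinom_mul_qPochhammer (Polynomial.X : Polynomial ℤ) k t
    have h2 := qBinom_mul_qPochhammer (Polynomial.X : Polynomial ℤ) t k
    rw [add_comm t k] at h2
    refine mul_right_cancel₀ (mul_ne_zero (qPochhammer_X_ne_zero k) (qPochhammer_X_ne_zero t)) ?_
    linear_combination h2 - h1
  have := congrArg (Polynomial.eval₂RingHom (Int.castRingHom R) q) key
  simp only [map_qBinom] at this
  simpa using this

/-- The `q`-binomial theorem. -/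
theorem sum_qBinom_eq_qPochhammer (q x : R) (n : ℕ) :
    ∑ k ∈ Finset.range (n + 1), (-x) ^ k * q ^ k.choose 2 * qBinom q n k = qPochhammer x q n := by
  induction n generalizing x with
  | zero => simp [qBinom, qPochhammer]
  | succ n ih =>
    -- Since `(x; q)_(n+1) = (1 - x) (xq; q)_n`, the two terms of the `q`-Pascal rule should
    -- contribute the sum at `xq` with factors `-x` and `1`.
    have h1 := ih (x * q)
    rw [Finset.sum_range_succ', show n + 1 = 1 + n by omega, qPochhammer_add, pow_one, ← h1,
      show 1 + n = n + 1 by omega]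
    have h2 : ∑ k ∈ Finset.range (n + 1), (-x) ^ (k + 1) * q ^ (k + 1).choose 2 *
        (q ^ (k + 1) * qBinom q n (k + 1)) + 1 =
        ∑ k ∈ Finset.range (n + 1), (-(x * q)) ^ k * q ^ k.choose 2 * qBinom q n k := by
      rw [Finset.sum_range_succ, qBinom_eq_zero q n (n + 1) (by omega),
        Finset.sum_range_succ' _ n]
      simp only [qBinom_zero_right, mul_zero, add_zero, Nat.choose_zero_succ, pow_zero, mul_one]
      congr 1
      refine Finset.sum_congr rfl fun k _ => ?_
      rw [neg_pow (x * q), neg_pow x, mul_pow]; ring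
    have h3 : ∑ k ∈ Finset.range (n + 1), (-x) ^ (k + 1) * q ^ (k + 1).choose 2 * qBinom q n k =
        -x * ∑ k ∈ Finset.range (n + 1), (-(x * q)) ^ k * q ^ k.choose 2 * qBinom q n k := by
      rw [Finset.mul_sum]
      refine Finset.sum_congr rfl fun k _ => ?_
      rw [Nat.choose_succ_succ' k 1, Nat.choose_one_right, neg_pow (x * q), neg_pow x, mul_pow]
      ring
    simp only [qBinom_succ_succ, mul_add, Finset.sum_add_distrib, h3]
    rw [add_assoc]
    simp only [qBinom_zero_right, pow_zero, Nat.choose_zero_succ, mul_one]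
    rw [h2]
    simp [qPochhammer]
    ring

/-- The `q`-Vandermonde identity. -/
theorem qBinom_add_eq_sum (q : R) (m n j : ℕ) :
    qBinom q (m + n) j =
      ∑ p ∈ antidiagonal j, qBinom q m p.1 * qBinom q n p.2 * q ^ (p.2 * (m - p.1)) := by
  induction m generalizing j with
  | zero =>
    rw [zero_add, Finset.sum_eq_single (0, j)]
    · simp [qBinom]
    · rintro ⟨l, i⟩ h1 h2
      rw [Finset.HasAntidiagonal.mem_antidiagonal] at h1
      rw [qBinom_eq_zero q 0 l, zero_mul, zero_mul]
      by_contra h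
      apply h2
      ext <;> simp at * <;> omega
    · simp
  | succ m ih =>
    cases j with
    | zero => simp [qBinom_zero_right]
    | succ j =>
      rw [show m + 1 + n = m + n + 1 by omega, qBinom_succ_succ, ih, ih,
        Finset.Nat.sum_antidiagonal_succ, Finset.Nat.sum_antidiagonal_succ, mul_add, Finset.mul_sum]
      simp only [qBinom_succ_succ, qBinom_zero_right, add_mul, Finset.sum_add_distrib,
        Nat.add_sub_add_right]
      have h : ∀ p ∈ antidiagonal j, q ^ (j + 1) * (qBinom q m (p.1 + 1) * qBinom q n p.2 *
          q ^ (p.2 * (m - (p.1 + 1)))) =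
          q ^ (p.1 + 1) * qBinom q m (p.1 + 1) * qBinom q n p.2 * q ^ (p.2 * (m - p.1)) := by
        rintro ⟨l, i⟩ hp
        rw [Finset.HasAntidiagonal.mem_antidiagonal] at hp
        dsimp only at hp ⊢
        rcases lt_or_ge m (l + 1) with hl | hl
        · rw [qBinom_eq_zero q m (l + 1) hl]; ring
        · obtain ⟨u, rfl⟩ := Nat.exists_eq_add_of_le' hl
          rw [show u + (l + 1) - (l + 1) = u by omega, show u + (l + 1) - l = u + 1 by omega, ← hp]
          ring
      rw [Finset.sum_congr rfl h]
      have h0 : q ^ (j + 1) * (1 * qBinom q n (j + 1) * q ^ (j * (m - 0) + 1 * (m - 0))) =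
          1 * qBinom q n (j + 1) * q ^ (j * (m + 1 - 0) + 1 * (m + 1 - 0)) := by
        simp only [Nat.sub_zero]; ring
      rw [h0]
      ring

end QBinomial

/-! ### Reindexing of nested sums -/

section Reindexing

variable {M : Type*} [AddCommMonoid M]

theorem sum_range_sum_range_sub (n : ℕ) (g : ℕ → ℕ → M) :
    ∑ k ∈ Finset.range (n + 1), ∑ t ∈ Finset.range (n - k + 1), g k t =
      ∑ s ∈ Finset.range (n + 1), ∑ p ∈ antidiagonal s, g p.1 p.2 := by
  rw [Finset.sum_sigma', Finset.sum_sigma']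
  refine Finset.sum_nbij' (fun x => ⟨x.1 + x.2, (x.1, x.2)⟩) (fun y => ⟨y.2.1, y.2.2⟩) ?_ ?_ ?_ ?_ ?_
  · rintro ⟨k, t⟩ h
    simp at h ⊢; omega
  · rintro ⟨s, k, t⟩ h
    simp at h ⊢; omega
  · rintro ⟨k, t⟩ h; rfl
  · rintro ⟨s, k, t⟩ h
    simp at h ⊢
    exact h.2
  · rintro ⟨k, t⟩ h; rfl

theorem sum_antidiagonal_assoc (s : ℕ) (g : ℕ → ℕ → ℕ → M) :
    ∑ p ∈ antidiagonal s, ∑ r ∈ antidiagonal p.2, g p.1 r.1 r.2 =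
      ∑ p ∈ antidiagonal s, ∑ r ∈ antidiagonal p.1, g r.1 r.2 p.2 := by
  rw [Finset.sum_sigma', Finset.sum_sigma']
  refine Finset.sum_nbij' (fun x => ⟨(x.1.1 + x.2.1, x.2.2), (x.1.1, x.2.1)⟩)
    (fun y => ⟨(y.2.1, y.2.2 + y.1.2), (y.2.2, y.1.2)⟩) ?_ ?_ ?_ ?_ ?_
  · rintro ⟨⟨a, b⟩, c, d⟩ h
    simp at h ⊢; omega
  · rintro ⟨⟨a, b⟩, c, d⟩ h
    simp at h ⊢; omega
  · rintro ⟨⟨a, b⟩, c, d⟩ h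
    simp at h ⊢
    obtain ⟨-, rfl⟩ := h; simp
  · rintro ⟨⟨a, b⟩, c, d⟩ h
    simp at h ⊢
    obtain ⟨-, rfl⟩ := h; simp
  · rintro ⟨⟨a, b⟩, c, d⟩ h; rfl

end Reindexing

theorem add_choose_two (i k : ℕ) : (i + k).choose 2 = i.choose 2 + k.choose 2 + i * k := by
  induction k with
  | zero => simp
  | succ k ih =>
    rw [← add_assoc, Nat.choose_succ_succ' (i + k) 1, Nat.choose_succ_succ' k 1, ih,
      Nat.choose_one_right, Nat.choose_one_right]
    ring

/-! ### Local relations between vertices -/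

section VertexRelations

variable {R : Type*} [CommRing R]

/-- The weight of a vertex of the (inhomogeneous) `q`-Whittaker model with bottom label `a` whose top
label exceeds its left label by `k`. -/
def whittakerVertex (q u x : R) (a k : ℕ) : R :=
  x ^ (a - k) * qPochhammer (u * x) q k * qBinom q a k

/-- The weight of a vertex of the expansion lattice with bottom label `a` whose top label exceeds its
left label by `k`. -/
def expansionVertex (q : R) (a k : ℕ) : R :=
  (-1) ^ k * q ^ k.choose 2 * qBinom q a k

theorem whittakerVertex_eq_zero (q u x : R) {a k : ℕ} (h : a < k) : whittakerVertex q u x a k = 0 := by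
  rw [whittakerVertex, qBinom_eq_zero q a k h, mul_zero]

/-- Trinomial revision extracts `[A choose i]`. After shifting `k` by `i`, the cross term of `(i +
k).choose 2` turns the rest into the `q`-binomial theorem at `x q^i`. -/
theorem sum_qBinom_mul_qBinom (q x : R) (A i : ℕ) :
    ∑ k ∈ Finset.range (A + 1), (-1) ^ k * q ^ k.choose 2 * qBinom q A k * qBinom q k i * x ^ (k - i) =
      (-1) ^ i * q ^ i.choose 2 * qBinom q A i * qPochhammer (x * q ^ i) q (A - i) := by
  rcases lt_or_ge A i with h | h
  · rw [qBinom_eq_zero q A i h, mul_zero, zero_mul]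
    refine Finset.sum_eq_zero fun k hk => ?_
    rw [qBinom_eq_zero q k i (by simp at hk; omega)]; ring
  obtain ⟨t, rfl⟩ := Nat.exists_eq_add_of_le h
  rw [show i + t + 1 = i + (t + 1) by omega, Finset.sum_range_add, Finset.sum_eq_zero, zero_add,
    show i + t - i = t by omega, ← sum_qBinom_eq_qPochhammer, Finset.mul_sum]
  · refine Finset.sum_congr rfl fun k _ => ?_
    have h := qBinom_mul_qBinom q (i + t) i k
    rw [show i + t - i = t by omega] at h
    rw [show i + k - i = k by omega, add_choose_two]
    rw [neg_pow (x * q ^ i)]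
    linear_combination (-1) ^ (i + k) * q ^ (i.choose 2 + k.choose 2 + i * k) * x ^ k * -h
  · intro k hk
    rw [qBinom_eq_zero q k i (by simpa using hk)]; ring

/-- The scalar content of the Yang-Baxter equation once the outgoing labels are fixed.
`q`-Vandermonde brings both sides to a common sum over `l + i = s` containing `(x; q)_A (x q^i;
q)_l`: on the left the inner sum is the `q`-binomial theorem, on the right it is
`sum_qBinom_mul_qBinom`. -/
theorem qPochhammer_mul_sum_eq (q x : R) (A s r : ℕ) :
    qPochhammer x q A * ∑ p ∈ antidiagonal s, x ^ (r - p.1) * qBinom q r p.1 *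
        ((-1) ^ p.2 * q ^ p.2.choose 2 * qBinom q (r - p.1 + A) p.2) =
      qPochhammer x q s * ∑ k ∈ Finset.range (A + 1),
        (-1) ^ k * q ^ k.choose 2 * qBinom q A k * x ^ (r + k - s) * qBinom q (r + k) s := by
  trans qPochhammer x q A * ∑ p ∈ antidiagonal s, qBinom q r p.1 * x ^ (r - p.1) *
    q ^ (p.2 * (r - p.1)) * ((-1) ^ p.2 * q ^ p.2.choose 2) * qBinom q A p.2 *
      qPochhammer (x * q ^ p.2) q p.1
  · congr 1
    have h1 : ∀ p ∈ antidiagonal s, x ^ (r - p.1) * qBinom q r p.1 *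
        ((-1) ^ p.2 * q ^ p.2.choose 2 * qBinom q (r - p.1 + A) p.2) =
        ∑ u ∈ antidiagonal p.2, x ^ (r - p.1) * qBinom q r p.1 *
          ((-1) ^ (u.1 + u.2) * q ^ (u.1 + u.2).choose 2 *
            (qBinom q (r - p.1) u.1 * qBinom q A u.2 * q ^ (u.2 * (r - p.1 - u.1)))) := by
      rintro p -
      rw [qBinom_add_eq_sum, Finset.mul_sum, Finset.mul_sum]
      refine Finset.sum_congr rfl fun u hu => ?_
      rw [Finset.HasAntidiagonal.mem_antidiagonal.1 hu]
    rw [Finset.sum_congr rfl h1, sum_antidiagonal_assoc s (fun k t i =>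
      x ^ (r - k) * qBinom q r k * ((-1) ^ (t + i) * q ^ (t + i).choose 2 *
            (qBinom q (r - k) t * qBinom q A i * q ^ (i * (r - k - t)))))]
    refine Finset.sum_congr rfl fun p _ => ?_
    obtain ⟨l, i⟩ := p
    dsimp only
    rcases lt_or_ge r l with hl | hl
    · rw [qBinom_eq_zero q r l hl]
      simp only [zero_mul]
      refine Finset.sum_eq_zero fun u hu => ?_
      rw [Finset.HasAntidiagonal.mem_antidiagonal] at hu
      have h := qBinom_mul_qBinom q r u.1 u.2
      rw [hu, qBinom_eq_zero q r l hl, zero_mul] at h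
      linear_combination x ^ (r - u.1) * ((-1) ^ (u.2 + i) * q ^ (u.2 + i).choose 2 *
            (qBinom q A i * q ^ (i * (r - u.1 - u.2)))) * h
    rw [← sum_qBinom_eq_qPochhammer, Finset.mul_sum,
      ← Finset.Nat.sum_antidiagonal_eq_sum_range_succ_mk (n := l)
        (f := fun u => qBinom q r l * x ^ (r - l) * q ^ (i * (r - l)) *
          ((-1) ^ i * q ^ i.choose 2) * qBinom q A i *
          ((-(x * q ^ i)) ^ u.1 * q ^ u.1.choose 2 * qBinom q l u.1)),
      ← Finset.Nat.sum_antidiagonal_swap]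
    refine Finset.sum_congr rfl fun u hu => ?_
    obtain ⟨t, k⟩ := u
    rw [Finset.HasAntidiagonal.mem_antidiagonal] at hu
    dsimp only [Prod.swap] at hu ⊢
    subst hu
    have h := qBinom_mul_qBinom q r k t
    rw [add_comm k t, ← qBinom_symm_add] at h
    obtain ⟨m, rfl⟩ := Nat.exists_eq_add_of_le' hl
    rw [show m + (t + k) - k = m + t by omega] at h ⊢
    rw [show m + t - t = m by omega, show m + (t + k) - (t + k) = m by omega, add_choose_two,
      neg_pow (x * q ^ i)]
    linear_combination x ^ (m + t) * (-1) ^ (t + i) * q ^ (t.choose 2 + i.choose 2 + t * i) *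
      qBinom q A i * q ^ (i * m) * h
  · have h1 : ∀ k, (-1) ^ k * q ^ k.choose 2 * qBinom q A k * x ^ (r + k - s) * qBinom q (r + k) s =
        ∑ p ∈ antidiagonal s, qBinom q r p.1 * x ^ (r - p.1) * q ^ (p.2 * (r - p.1)) *
          ((-1) ^ k * q ^ k.choose 2 * qBinom q A k * qBinom q k p.2 * x ^ (k - p.2)) := by
      intro k
      rw [qBinom_add_eq_sum, Finset.mul_sum]
      refine Finset.sum_congr rfl fun p hp => ?_
      rw [Finset.HasAntidiagonal.mem_antidiagonal] at hp
      rcases lt_or_ge r p.1 with hl | hl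
      · rw [qBinom_eq_zero q r p.1 hl]; ring
      rcases lt_or_ge k p.2 with hi | hi
      · rw [qBinom_eq_zero q k p.2 hi]; ring
      rw [show r + k - s = (r - p.1) + (k - p.2) by omega]
      ring
    simp only [h1]
    rw [Finset.sum_comm]
    simp only [← Finset.mul_sum, sum_qBinom_mul_qBinom]
    rw [Finset.mul_sum, Finset.mul_sum]
    refine Finset.sum_congr rfl fun p hp => ?_
    obtain ⟨l, i⟩ := p
    rw [Finset.HasAntidiagonal.mem_antidiagonal] at hp
    dsimp only at hp ⊢
    rcases lt_or_ge A i with hi | hi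
    · rw [qBinom_eq_zero q A i hi]; ring
    rw [← hp, add_comm l i, qPochhammer_add x q i l]
    nth_rewrite 1 [show A = i + (A - i) by omega]
    rw [qPochhammer_add x q i (A - i)]
    ring

/-- The Yang-Baxter equation for a vertical line, a horizontal line, and a line carrying `x`. -/
theorem vertex_yang_baxter (q x : R) (a b r : ℕ) (f : ℕ → ℕ → ℕ → R) :
    ∑ k₀ ∈ Finset.range (r + 1), whittakerVertex q 0 x r k₀ *
      ∑ k₁ ∈ Finset.range (a + 1), whittakerVertex q 1 x a k₁ *
        ∑ k₂ ∈ Finset.range (r - k₀ + k₁ + 1), expansionVertex q (r - k₀ + k₁) k₂ *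
          f (b + k₀ + k₂) (r - k₀ + k₁ - k₂) (a - k₁) =
      ∑ k ∈ Finset.range (a + 1), expansionVertex q a k *
        ∑ k₁ ∈ Finset.range (r + k + 1), whittakerVertex q 1 x (r + k) k₁ *
          ∑ k₀ ∈ Finset.range (a - k + 1), whittakerVertex q 0 x (a - k) k₀ *
            f (b + k₁) (r + k - k₁ + k₀) (a - k - k₀) := by
  -- Terms are grouped by the arguments of `f`: `A = k₁`, `s = k₀ + k₂` on the left, and `A = k +
  -- k₀`, `s = k₁` on the right.
  trans ∑ A ∈ Finset.range (a + 1), ∑ s ∈ Finset.range (r + A + 1),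
      x ^ (a - A) * qBinom q a A * (qPochhammer x q A *
        ∑ p ∈ antidiagonal s, x ^ (r - p.1) * qBinom q r p.1 *
        ((-1) ^ p.2 * q ^ p.2.choose 2 * qBinom q (r - p.1 + A) p.2)) *
      f (b + s) (r + A - s) (a - A)
  · simp only [Finset.mul_sum]
    rw [Finset.sum_comm]
    refine Finset.sum_congr rfl fun A hA => ?_
    trans ∑ k₀ ∈ Finset.range (r + A + 1), ∑ k₂ ∈ Finset.range (r + A - k₀ + 1),
      whittakerVertex q 0 x r k₀ * (whittakerVertex q 1 x a A *
        (expansionVertex q (r - k₀ + A) k₂ * f (b + k₀ + k₂) (r - k₀ + A - k₂) (a - A)))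
    -- The terms with `k₀ > r` vanish, so the range can be enlarged to a full triangle.
    · rw [show r + A + 1 = r + 1 + A by omega, Finset.sum_range_add _ (r + 1) A]
      rw [Finset.sum_eq_zero (s := Finset.range A), add_zero]
      · refine Finset.sum_congr rfl fun k hk => ?_
        rw [show r - k + A + 1 = r + A - k + 1 by simp at hk; omega]
      · intro k hk
        refine Finset.sum_eq_zero fun k₂ _ => ?_
        rw [whittakerVertex_eq_zero q 0 x (by omega), zero_mul]
    rw [sum_range_sum_range_sub (r + A) (fun k₀ k₂ => whittakerVertex q 0 x r k₀ *
      (whittakerVertex q 1 x a A *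
        (expansionVertex q (r - k₀ + A) k₂ * f (b + k₀ + k₂) (r - k₀ + A - k₂) (a - A))))]
    refine Finset.sum_congr rfl fun s hs => ?_
    rw [Finset.sum_mul]
    refine Finset.sum_congr rfl fun p hp => ?_
    obtain ⟨k, j⟩ := p
    rw [Finset.HasAntidiagonal.mem_antidiagonal] at hp
    dsimp only at hp ⊢
    rcases lt_or_ge r k with hk | hk
    · rw [whittakerVertex_eq_zero q 0 x hk, qBinom_eq_zero q r k hk]; ring
    rw [show b + k + j = b + s by omega, show r - k + A - j = r + A - s by omega]
    simp only [whittakerVertex, expansionVertex, zero_mul, one_mul, qPochhammer_zero_left]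
    ring
  · simp only [qPochhammer_mul_sum_eq]
    simp only [Finset.mul_sum, Finset.sum_mul]
    trans ∑ k ∈ Finset.range (a + 1), ∑ k₀ ∈ Finset.range (a - k + 1),
      ∑ s ∈ Finset.range (r + (k + k₀) + 1), expansionVertex q a k *
        (whittakerVertex q 1 x (r + k) s * (whittakerVertex q 0 x (a - k) k₀ *
          f (b + s) (r + (k + k₀) - s) (a - (k + k₀))))
    · rw [sum_range_sum_range_sub a (fun k k₀ =>
        ∑ s ∈ Finset.range (r + (k + k₀) + 1), expansionVertex q a k *
        (whittakerVertex q 1 x (r + k) s * (whittakerVertex q 0 x (a - k) k₀ *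
          f (b + s) (r + (k + k₀) - s) (a - (k + k₀)))))]
      refine Finset.sum_congr rfl fun A hA => ?_
      rw [Finset.sum_comm, ← Finset.Nat.sum_antidiagonal_eq_sum_range_succ_mk (n := A)
        (f := fun p => ∑ s ∈ Finset.range (r + A + 1), x ^ (a - A) * qBinom q a A *
          (qPochhammer x q s * ((-1) ^ p.1 * q ^ p.1.choose 2 * qBinom q A p.1 *
            x ^ (r + p.1 - s) * qBinom q (r + p.1) s)) * f (b + s) (r + A - s) (a - A))]
      refine Finset.sum_congr rfl fun p hp => ?_
      obtain ⟨k, k₀⟩ := p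
      rw [Finset.HasAntidiagonal.mem_antidiagonal] at hp
      dsimp only at hp ⊢
      rw [hp]
      refine Finset.sum_congr rfl fun s _ => ?_
      have h := qBinom_mul_qBinom q a k k₀
      rw [hp] at h
      simp only [whittakerVertex, expansionVertex, zero_mul, one_mul, qPochhammer_zero_left]
      rw [show a - k - k₀ = a - A by omega]
      linear_combination -(x ^ (a - A) * qPochhammer x q s * (-1) ^ k * q ^ k.choose 2 *
        x ^ (r + k - s) * qBinom q (r + k) s * f (b + s) (r + A - s) (a - A)) * h
    · refine Finset.sum_congr rfl fun k hk => ?_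
      rw [Finset.sum_comm]
      refine Finset.sum_congr rfl fun k₀ _ => ?_
      rw [show r + (k + k₀) + 1 = r + k + 1 + k₀ by omega, Finset.sum_range_add _ (r + k + 1) k₀,
        Finset.sum_eq_zero (s := Finset.range k₀), add_zero]
      · refine Finset.sum_congr rfl fun s hs => ?_
        rw [show r + (k + k₀) - s = r + k - s + k₀ by simp at hs; omega, ← Nat.sub_sub]
      · intro s _
        rw [whittakerVertex_eq_zero q 1 x (by omega)]; ring

/-- A vertex with vertical parameter `1` factors into an expansion vertex and a vertex with vertical
parameter `0`. -/
theorem vertex_factorization (q x : R) (a b : ℕ) (f : ℕ → ℕ → R) :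
    x ^ b * ∑ k ∈ Finset.range (a + 1), whittakerVertex q 1 x a k * f (b + k) (a - k) =
      ∑ m ∈ Finset.range (a + 1), expansionVertex q a m * (x ^ (b + m) *
        ∑ k ∈ Finset.range (a - m + 1), whittakerVertex q 0 x (a - m) k *
          f (b + m + k) (a - m - k)) := by
  simp only [Finset.mul_sum]
  rw [sum_range_sum_range_sub a (fun m k => expansionVertex q a m * (x ^ (b + m) *
        (whittakerVertex q 0 x (a - m) k * f (b + m + k) (a - m - k))))]
  refine Finset.sum_congr rfl fun s _ => ?_
  -- Expanding `(x; q)_s` splits `s` as `m + k`; trinomial revision then matches the terms one by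
  -- one.
  rw [whittakerVertex, one_mul, ← sum_qBinom_eq_qPochhammer,
    ← Finset.Nat.sum_antidiagonal_eq_sum_range_succ_mk (n := s)
      (f := fun p => (-x) ^ p.1 * q ^ p.1.choose 2 * qBinom q s p.1)]
  simp only [Finset.mul_sum, Finset.sum_mul]
  refine Finset.sum_congr rfl fun p hp => ?_
  obtain ⟨m, k⟩ := p
  rw [Finset.HasAntidiagonal.mem_antidiagonal] at hp
  dsimp only at hp ⊢
  have h := qBinom_mul_qBinom q a m k
  rw [hp] at h
  rw [show b + m + k = b + s by omega, show a - m - k = a - s by omega, neg_pow x]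
  simp only [whittakerVertex, expansionVertex, zero_mul, qPochhammer_zero_left]
  rw [show a - m - k = a - s by omega]
  linear_combination -(x ^ (b + m) * (-1) ^ m * q ^ m.choose 2 * x ^ (a - s) *
    f (b + s) (a - s)) * h

end VertexRelations

/-! ### Transfer operators and the intertwining relation -/

section Operators

variable {R : Type*} [CommRing R]

/-- The row transfer operator with vertex weights `w`: bottom labels `a`, left label `b`, and test
function `f` in the top labels and the right label. -/
def rowOp (w : ℕ → ℕ → R) : (N : ℕ) → (Fin N → ℕ) → ℕ → ((Fin N → ℕ) → ℕ → R) → R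
  | 0, a, b, f => f a b
  | N + 1, a, b, f => ∑ k ∈ Finset.range (a 0 + 1), w (a 0) k *
      rowOp w N (Fin.tail a) (a 0 - k) fun c d => f (Fin.cons (b + k) c) d

/-- The triangular part of the expansion lattice, with bottom labels `a` and test function `f` in the
right labels. -/
def triangleOp (q : R) : (n : ℕ) → (Fin n → ℕ) → ((Fin n → ℕ) → R) → R
  | 0, a, f => f a
  | n + 1, a, f => rowOp (expansionVertex q) n (Fin.tail a) (a 0) fun c d =>
      triangleOp q n c fun m => f (Fin.cons d m)

/-- One step of the branching rule of `q`-Whittaker polynomials, as an operator on column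
multiplicities. -/
def branchOp (q x : R) : (n : ℕ) → (Fin (n + 1) → ℕ) → ((Fin n → ℕ) → ℕ → R) → R
  | 0, m, f => x ^ m 0 * f (Fin.tail m) (m 0)
  | n + 1, m, f => branchOp q x n (Fin.tail m) fun c d =>
      ∑ k ∈ Finset.range (m 0 + 1), whittakerVertex q 0 x (m 0) k * f (Fin.cons (d + k) c) (m 0 - k)

theorem rowOp_sum_mul (w : ℕ → ℕ → R) {ι : Type*} (s : Finset ι) (r : ι → R) {N : ℕ}
    (a : Fin N → ℕ) (b : ℕ) (f : ι → (Fin N → ℕ) → ℕ → R) :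
    rowOp w N a b (fun c d => ∑ i ∈ s, r i * f i c d) = ∑ i ∈ s, r i * rowOp w N a b (f i) := by
  induction N generalizing b with
  | zero => rfl
  | succ N ih =>
    simp only [rowOp, Finset.mul_sum]
    rw [Finset.sum_comm]
    refine Finset.sum_congr rfl fun k _ => ?_
    rw [ih (Fin.tail a) (a 0 - k) (fun i c d => f i (Fin.cons (b + k) c) d), Finset.mul_sum]
    exact Finset.sum_congr rfl fun i _ => by ring

theorem triangleOp_sum_mul (q : R) {ι : Type*} (s : Finset ι) (r : ι → R) {n : ℕ}
    (a : Fin n → ℕ) (f : ι → (Fin n → ℕ) → R) :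
    triangleOp q n a (fun m => ∑ i ∈ s, r i * f i m) = ∑ i ∈ s, r i * triangleOp q n a (f i) := by
  induction n with
  | zero => rfl
  | succ n ih =>
    simp only [triangleOp]
    rw [← rowOp_sum_mul]
    congr 1
    funext c d
    exact ih c fun i m => f i (Fin.cons d m)

theorem rowOp_mul (w : ℕ → ℕ → R) (r : R) {N : ℕ} (a : Fin N → ℕ) (b : ℕ)
    (f : (Fin N → ℕ) → ℕ → R) :
    rowOp w N a b (fun c d => r * f c d) = r * rowOp w N a b f := by
  simpa using rowOp_sum_mul w {()} (fun _ => r) a b (fun _ => f)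

/-- The Yang-Baxter equation for whole rows. -/
theorem row_yang_baxter (q x : R) {N : ℕ} (a : Fin N → ℕ) (b r : ℕ)
    (f : (Fin N → ℕ) → ℕ → ℕ → R) :
    ∑ k ∈ Finset.range (r + 1), whittakerVertex q 0 x r k *
        rowOp (whittakerVertex q 1 x) N a (r - k) (fun c d =>
          rowOp (expansionVertex q) N c (b + k) fun e s => f e s d) =
      rowOp (expansionVertex q) N a r (fun c r' =>
        rowOp (whittakerVertex q 1 x) N c b fun e b' =>
          ∑ k ∈ Finset.range (r' + 1), whittakerVertex q 0 x r' k * f e (b' + k) (r' - k)) := by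
  induction N generalizing b r with
  | zero => rfl
  | succ N ih =>
    simp only [rowOp, Fin.cons_zero, Fin.tail_cons, rowOp_sum_mul]
    -- The local relation exchanges the lines at the leftmost column; the induction hypothesis
    -- handles the columns to its right.
    rw [vertex_yang_baxter q x (a 0) b r (fun c s d =>
      rowOp (whittakerVertex q 1 x) N (Fin.tail a) d fun c' d' =>
        rowOp (expansionVertex q) N c' s fun e s' => f (Fin.cons c e) s' d')]
    refine Finset.sum_congr rfl fun k _ => ?_
    congr 1
    refine Finset.sum_congr rfl fun k₁ _ => ?_
    congr 1
    rw [ih (Fin.tail a) (r + k - k₁) (a 0 - k) fun e s d => f (Fin.cons (b + k₁) e) s d]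
    simp only [rowOp_sum_mul]

/-- The expansion lattice intertwines the transfer operators with vertical parameters `1` and `0`. -/
theorem triangleOp_branchOp (q x : R) {n : ℕ} (a : Fin n → ℕ) (b : ℕ)
    (f : (Fin n → ℕ) → ℕ → R) :
    x ^ b * rowOp (whittakerVertex q 1 x) n a b (fun c d => triangleOp q n c fun m => f m d) =
      triangleOp q (n + 1) (Fin.cons b a) fun m => branchOp q x n m f := by
  induction n generalizing b with
  | zero => simp [rowOp, triangleOp, branchOp, Fin.tail_cons]
  | succ n ih =>
    -- The first column has no expansion vertex yet in the smaller triangle; factoring its `u = 1`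
    -- vertex supplies one, together with a `u = 0` vertex.
    have h := vertex_factorization q x (a 0) b (fun c y =>
      rowOp (whittakerVertex q 1 x) n (Fin.tail a) y fun cs d =>
        rowOp (expansionVertex q) n cs c fun es s => triangleOp q n es fun m => f (Fin.cons s m) d)
    simp only [rowOp, triangleOp, Fin.cons_zero, Fin.tail_cons, branchOp] at h ⊢
    rw [h]
    refine Finset.sum_congr rfl fun m _ => ?_
    congr 1
    -- The `u = 0` vertex moves from the left end of the two rows to the right end, where it becomes
    -- the outermost vertex of `branchOp`.
    rw [row_yang_baxter q x (Fin.tail a) (b + m) (a 0 - m)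
      (fun es s d => triangleOp q n es fun m => f (Fin.cons s m) d), ← rowOp_mul]
    congr 1
    funext c r
    simp only [← triangleOp_sum_mul]
    -- The remaining `u = 1` row now faces a triangle with one column fewer; the transported vertex
    -- is absorbed into the test function.
    have h2 := ih c (b + m) fun ms s => ∑ k ∈ Finset.range (r + 1),
      whittakerVertex q 0 x r k * f (Fin.cons (s + k) ms) (r - k)
    simpa only [triangleOp, Fin.cons_zero, Fin.tail_cons] using h2

/-- The inhomogeneous `q`-Whittaker polynomial with column multiplicities `a`, by its branching
rule. -/
def inhomRec (q : R) : (n : ℕ) → (Fin n → R) → (Fin n → ℕ) → R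
  | 0, _, _ => 1
  | n + 1, x, a => x (Fin.last n) ^ a 0 *
      rowOp (whittakerVertex q 1 (x (Fin.last n))) n (Fin.tail a) (a 0) fun c _ =>
        inhomRec q n (fun i => x i.castSucc) c

/-- The `q`-Whittaker polynomial with column multiplicities `m`, by its branching rule. -/
def whittakerRec (q : R) : (n : ℕ) → (Fin n → R) → (Fin n → ℕ) → R
  | 0, _, _ => 1
  | n + 1, x, m => branchOp q (x (Fin.last n)) n m fun c _ =>
      whittakerRec q n (fun i => x i.castSucc) c

/-- The induction hypothesis puts a triangle after the row carrying the last variable; the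
intertwining relation turns that row into a branching step. -/
theorem inhomRec_eq_triangleOp (q : R) {n : ℕ} (x : Fin n → R) (a : Fin n → ℕ) :
    inhomRec q n x a = triangleOp q n a (whittakerRec q n x) := by
  induction n with
  | zero => rfl
  | succ n ih =>
    rw [← Fin.cons_self_tail a]
    simp only [inhomRec, ih, Fin.cons_zero, Fin.tail_cons]
    exact triangleOp_branchOp q (x (Fin.last n)) (Fin.tail a) (a 0) fun c _ =>
      whittakerRec q n (fun i => x i.castSucc) c

end Operators

/-! ### From lattice partition functions to transfer operators -/

section Lattice

variable {R : Type*} [CommRing R]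

/-- The weight of a vertex with bottom, left, top and right labels `a`, `b`, `c`, `d`, given in terms
of `a` and `c - b`. -/
def vertexWeight (v : ℕ → ℕ → R) (a b c d : ℕ) : R :=
  if a + b = c + d ∧ b ≤ c then v a (c - b) else 0

theorem vertexWeight_add (v : ℕ → ℕ → R) {a k : ℕ} (b : ℕ) (h : k ≤ a) :
    vertexWeight v a b (b + k) (a - k) = v a k := by
  rw [vertexWeight, if_pos (by omega), Nat.add_sub_cancel_left]

theorem inhomWeight_eq_vertexWeight (q u x : R) :
    inhomWeight q u x = vertexWeight (whittakerVertex q u x) := by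
  funext a b c d
  unfold inhomWeight vertexWeight whittakerVertex
  refine if_ctx_congr Iff.rfl (fun h => ?_) fun _ => rfl
  rw [show a - (c - b) = d by omega]

theorem expansionWeight_eq_vertexWeight (q : R) :
    expansionWeight q = vertexWeight (expansionVertex q) := rfl

theorem add_eq_add_of_vertexWeight_ne_zero (v : ℕ → ℕ → R) (a b c d : ℕ)
    (h : vertexWeight v a b c d ≠ 0) : a + b = c + d := by
  by_contra h'
  exact h (if_neg fun h'' => h' h''.1)

/-- A Fubini rule for cutting a configuration in two. A `finsum` with infinite support is `0` by
convention, so finiteness is needed both to iterate the sum and to pull `u` out. -/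
theorem finsum_mem_fiberwise {σ α β : Type*} (e : α × β → σ) (S : Set σ) (Q : Set α)
    (P : α → Set β) (he : Set.BijOn e {x | x.1 ∈ Q ∧ x.2 ∈ P x.1} S) (F : σ → R)
    (hF : (S ∩ Function.support F).Finite) (u : α → R) (v : α → β → R)
    (huv : ∀ x : α × β, x.1 ∈ Q → x.2 ∈ P x.1 → F (e x) = u x.1 * v x.1 x.2)
    (hv : ∀ a, (P a ∩ Function.support (v a)).Finite) :
    ∑ᶠ s ∈ S, F s = ∑ᶠ a ∈ Q, u a * ∑ᶠ b ∈ P a, v a b := by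
  classical
  have h1 : ∑ᶠ x ∈ {x : α × β | x.1 ∈ Q ∧ x.2 ∈ P x.1}, u x.1 * v x.1 x.2 = ∑ᶠ s ∈ S, F s :=
    finsum_mem_eq_of_bijOn e he fun x hx => (huv x hx.1 hx.2).symm
  rw [← h1, finsum_mem_def, finsum_curry, finsum_mem_def]
  · refine finsum_congr fun a => ?_
    by_cases ha : a ∈ Q
    · rw [Set.indicator_of_mem ha, finsum_mem_def, mul_finsum']
      · refine finsum_congr fun b => ?_
        by_cases hb : b ∈ P a
        · rw [Set.indicator_of_mem (show (a, b) ∈ {x : α × β | x.1 ∈ Q ∧ x.2 ∈ P x.1} from ⟨ha, hb⟩),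
            Set.indicator_of_mem hb]
        · rw [Set.indicator_of_notMem (fun h => hb h.2), Set.indicator_of_notMem hb, mul_zero]
      · rw [Function.HasFiniteSupport, Set.support_indicator]
        exact hv a
    · rw [Set.indicator_of_notMem ha]
      exact finsum_eq_zero_of_forall_eq_zero fun b => Set.indicator_of_notMem (fun h => ha h.1) _
  · rw [Function.HasFiniteSupport, Set.support_indicator]
    refine Set.Finite.of_finite_image (f := e) (hF.subset ?_) (he.injOn.mono Set.inter_subset_left)
    rintro _ ⟨x, ⟨hx, hx'⟩, rfl⟩
    refine ⟨he.mapsTo hx, ?_⟩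
    rw [Function.mem_support, huv x hx.1 hx.2]
    exact hx'

theorem finite_rowConfigurations (v : ℕ → ℕ → R) {N : ℕ} (a : Fin N → ℕ) (b : ℕ)
    (f : (Fin N → ℕ) → ℕ → R) :
    ({p : (Fin N → ℕ) × (Fin (N + 1) → ℕ) | p.2 0 = b} ∩ Function.support fun p =>
      (∏ j, vertexWeight v (a j) (p.2 j.castSucc) (p.1 j) (p.2 j.succ)) *
        f p.1 (p.2 (Fin.last N))).Finite := by
  -- A row is viewed as a lattice of height one.
  refine Set.Finite.of_finite_image
    (f := fun p => ((![a, p.1], fun _ => p.2) :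
      (Fin (1 + 1) → Fin N → ℕ) × (Fin 1 → Fin (N + 1) → ℕ)))
    ((latticePartitionFunction_finite (fun _ _ => vertexWeight v)
      (fun _ _ => add_eq_add_of_vertexWeight_ne_zero v) a fun _ => b).subset ?_) ?_
  · rintro _ ⟨p, ⟨hp, hp'⟩, rfl⟩
    refine ⟨rfl, funext fun _ => hp, ?_⟩
    simpa using left_ne_zero_of_mul hp'
  · rintro p - p' - h
    simp only [Prod.mk.injEq] at h
    exact Prod.ext (congrFun h.1 1) (congrFun h.2 0)

theorem finsum_vertex (v : ℕ → ℕ → R) (a b : ℕ) (f : ℕ → ℕ → R) :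
    ∑ᶠ p : ℕ × ℕ, vertexWeight v a b p.1 p.2 * f p.1 p.2 =
      ∑ k ∈ Finset.range (a + 1), v a k * f (b + k) (a - k) := by
  classical
  rw [finsum_eq_sum_of_support_subset (s := (Finset.range (a + 1)).image fun k => (b + k, a - k)),
    Finset.sum_image]
  · refine Finset.sum_congr rfl fun k hk => ?_
    rw [vertexWeight_add v b (by simpa [Nat.lt_succ_iff] using hk)]
  · intro k _ k' _ h
    simpa using (Prod.ext_iff.1 h).1
  · rintro ⟨c, d⟩ h
    have h' := left_ne_zero_of_mul h
    simp only [vertexWeight, ne_eq, ite_eq_right_iff, Classical.not_imp] at h'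
    simp only [Finset.coe_image, Set.mem_image, Finset.mem_coe, Finset.mem_range, Prod.mk.injEq]
    exact ⟨c - b, by omega, by omega, by omega⟩

/-- The sum over the configurations of a single row is given by the row transfer operator. -/
theorem finsum_rowConfigurations (v : ℕ → ℕ → R) {N : ℕ} (a : Fin N → ℕ) (b : ℕ)
    (f : (Fin N → ℕ) → ℕ → R) :
    ∑ᶠ p ∈ {p : (Fin N → ℕ) × (Fin (N + 1) → ℕ) | p.2 0 = b},
      (∏ j, vertexWeight v (a j) (p.2 j.castSucc) (p.1 j) (p.2 j.succ)) *
        f p.1 (p.2 (Fin.last N)) = rowOp v N a b f := by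
  induction N generalizing b with
  | zero =>
    have h : {p : (Fin 0 → ℕ) × (Fin (0 + 1) → ℕ) | p.2 0 = b} = {(a, fun _ => b)} := by
      ext p
      simp only [Set.mem_ofPred_eq, Set.mem_singleton_iff, Prod.ext_iff]
      refine ⟨fun h => ⟨Subsingleton.elim _ _, funext fun i => ?_⟩, fun h => congrFun h.2 0⟩
      rw [Subsingleton.elim (α := Fin 1) i 0, h]
    rw [h, finsum_mem_singleton]
    simp [rowOp]
  | succ N ih =>
    -- The row is cut after its first vertex: `y` holds the top and right labels of that vertex, and
    -- `y.2` is the left label of the rest.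
    rw [finsum_mem_fiberwise (α := ℕ × ℕ) (β := (Fin N → ℕ) × (Fin (N + 1) → ℕ))
      (fun x => (Fin.cons x.1.1 x.2.1, Fin.cons b x.2.2)) _ Set.univ (fun y => {p | p.2 0 = y.2}) ?_ _
      (finite_rowConfigurations v a b f) (fun y => vertexWeight v (a 0) b y.1 y.2)
      (fun y p => (∏ j, vertexWeight v (Fin.tail a j) (p.2 j.castSucc) (p.1 j) (p.2 j.succ)) *
        f (Fin.cons y.1 p.1) (p.2 (Fin.last N))) ?_
      (fun y => finite_rowConfigurations v (Fin.tail a) y.2 fun c d => f (Fin.cons y.1 c) d)]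
    · simp only [fun y : ℕ × ℕ => ih (Fin.tail a) y.2 fun c d => f (Fin.cons y.1 c) d, finsum_mem_univ]
      rw [finsum_vertex v (a 0) b fun t d => rowOp v N (Fin.tail a) d fun c d => f (Fin.cons t c) d]
      rfl
    · refine ⟨fun x _ => by simp, ?_, ?_⟩
      · rintro ⟨⟨t, d⟩, c, h⟩ ⟨-, h1⟩ ⟨⟨t', d'⟩, c', h'⟩ ⟨-, h1'⟩ h2
        simp only [Prod.mk.injEq, Fin.cons_inj, Set.mem_ofPred_eq] at h1 h1' h2 ⊢
        obtain ⟨⟨rfl, rfl⟩, -, rfl⟩ := h2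
        exact ⟨⟨rfl, h1 ▸ h1'⟩, rfl, rfl⟩
      · rintro ⟨c, h⟩ hb
        refine ⟨((c 0, h 1), (Fin.tail c, Fin.tail h)), ⟨trivial, rfl⟩, ?_⟩
        simp only [Set.mem_ofPred_eq] at hb
        simp [← hb]
    · rintro ⟨⟨t, d⟩, c, h⟩ - h1
      simp only [Set.mem_ofPred_eq] at h1
      rw [Fin.prod_univ_succ]
      simp only [← Fin.succ_castSucc, ← Fin.succ_last, Fin.cons_succ, Fin.cons_zero, Fin.castSucc_zero]
      simp only [h1, Fin.tail, mul_assoc]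

/-- The partition function of a lattice with vanishing top and left labels, row by row, with a test
function in the right labels. -/
noncomputable def latticeRec {N : ℕ} : (r : ℕ) → (Fin r → ℕ → ℕ → R) → (Fin N → ℕ) →
    ((Fin r → ℕ) → R) → R
  | 0, _, a, g => open Classical in if a = 0 then g Fin.elim0 else 0
  | r + 1, v, a, g => rowOp (v 0) N a 0 fun c d =>
      latticeRec r (Fin.tail v) c fun m => g (Fin.cons d m)

theorem finite_latticeConfigurations {N r : ℕ} (v : Fin r → ℕ → ℕ → R) (a : Fin N → ℕ)
    (g : (Fin N → ℕ) → (Fin r → ℕ) → R) :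
    ({s : (Fin (r + 1) → Fin N → ℕ) × (Fin r → Fin (N + 1) → ℕ) |
        s.1 0 = a ∧ (fun i => s.2 i 0) = fun _ => 0} ∩ Function.support fun s =>
      (∏ i : Fin r, ∏ j : Fin N, vertexWeight (v i) (s.1 i.castSucc j) (s.2 i j.castSucc)
        (s.1 i.succ j) (s.2 i j.succ)) * g (s.1 (Fin.last r)) fun i => s.2 i (Fin.last N)).Finite := by
  refine (latticePartitionFunction_finite (fun i _ => vertexWeight (v i))
    (fun i _ => add_eq_add_of_vertexWeight_ne_zero (v i)) a fun _ => 0).subset ?_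
  rintro s ⟨⟨h1, h2⟩, h3⟩
  exact ⟨h1, h2, left_ne_zero_of_mul h3⟩

open Classical in
theorem finsum_latticeConfigurations {N r : ℕ} (v : Fin r → ℕ → ℕ → R) (a : Fin N → ℕ)
    (g : (Fin r → ℕ) → R) :
    ∑ᶠ s ∈ {s : (Fin (r + 1) → Fin N → ℕ) × (Fin r → Fin (N + 1) → ℕ) |
        s.1 0 = a ∧ (fun i => s.2 i 0) = fun _ => 0},
      (∏ i : Fin r, ∏ j : Fin N, vertexWeight (v i) (s.1 i.castSucc j) (s.2 i j.castSucc)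
        (s.1 i.succ j) (s.2 i j.succ)) *
          (if s.1 (Fin.last r) = 0 then g fun i => s.2 i (Fin.last N) else 0) =
      latticeRec r v a g := by
  induction r generalizing a with
  | zero =>
    have h : {s : (Fin (0 + 1) → Fin N → ℕ) × (Fin 0 → Fin (N + 1) → ℕ) |
        s.1 0 = a ∧ (fun i => s.2 i 0) = fun _ => 0} = {(fun _ => a, Fin.elim0)} := by
      ext s
      simp only [Set.mem_ofPred_eq, Set.mem_singleton_iff, Prod.ext_iff]
      refine ⟨fun h => ⟨funext fun i => ?_, Subsingleton.elim _ _⟩,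
        fun h => ⟨congrFun h.1 0, Subsingleton.elim _ _⟩⟩
      rw [Subsingleton.elim (α := Fin 1) i 0, h.1]
    rw [h, finsum_mem_singleton]
    simp only [Finset.univ_eq_empty, Finset.prod_empty, one_mul, latticeRec]
    congr
    exact Subsingleton.elim _ _
  | succ r ih =>
    -- The lattice is cut above its bottom row, whose top labels `p.1` are the bottom labels of the
    -- rest.
    rw [finsum_mem_fiberwise (α := (Fin N → ℕ) × (Fin (N + 1) → ℕ))
      (β := (Fin (r + 1) → Fin N → ℕ) × (Fin r → Fin (N + 1) → ℕ))
      (fun x => (Fin.cons a x.2.1, Fin.cons x.1.2 x.2.2)) _ {p | p.2 0 = 0}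
      (fun p => {s | s.1 0 = p.1 ∧ (fun i => s.2 i 0) = fun _ => 0}) ?_ _
      (finite_latticeConfigurations v a fun t m => if t = 0 then g m else 0)
      (fun p => ∏ j, vertexWeight (v 0) (a j) (p.2 j.castSucc) (p.1 j) (p.2 j.succ))
      (fun p s => (∏ i : Fin r, ∏ j : Fin N, vertexWeight (Fin.tail v i) (s.1 i.castSucc j)
        (s.2 i j.castSucc) (s.1 i.succ j) (s.2 i j.succ)) *
          (if s.1 (Fin.last r) = 0 then g (Fin.cons (p.2 (Fin.last N)) fun i => s.2 i (Fin.last N))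
            else 0)) ?_
      (fun p => finite_latticeConfigurations (Fin.tail v) p.1 fun t m =>
        if t = 0 then g (Fin.cons (p.2 (Fin.last N)) m) else 0)]
    · simp only [fun p : (Fin N → ℕ) × (Fin (N + 1) → ℕ) =>
        ih (Fin.tail v) p.1 fun m => g (Fin.cons (p.2 (Fin.last N)) m)]
      exact finsum_rowConfigurations (v 0) a 0 fun c d =>
        latticeRec r (Fin.tail v) c fun m => g (Fin.cons d m)
    · refine ⟨?_, ?_, ?_⟩
      · rintro ⟨⟨t, h⟩, V, H⟩ ⟨h1, -, h2⟩
        refine ⟨rfl, funext fun i => ?_⟩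
        refine Fin.cases h1 (fun i => ?_) i
        exact congrFun h2 i
      · rintro ⟨⟨t, h⟩, V, H⟩ ⟨-, h1, -⟩ ⟨⟨t', h'⟩, V', H'⟩ ⟨-, h1', -⟩ h2
        simp only [Prod.mk.injEq, Fin.cons_inj] at h1 h1' h2 ⊢
        obtain ⟨⟨-, rfl⟩, rfl, rfl⟩ := h2
        exact ⟨⟨h1 ▸ h1', rfl⟩, rfl, rfl⟩
      · rintro ⟨V, H⟩ ⟨h1, h2⟩
        refine ⟨((V 1, H 0), (Fin.tail V, Fin.tail H)),
          ⟨congrFun h2 0, rfl, funext fun i => congrFun h2 i.succ⟩, ?_⟩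
        simp only at h1
        simp [← h1]
    · rintro ⟨⟨t, h⟩, V, H⟩ h1 ⟨h2, -⟩
      simp only [Set.mem_ofPred_eq] at h1 h2
      rw [Fin.prod_univ_succ]
      simp only [← Fin.succ_castSucc, ← Fin.succ_last, Fin.cons_succ, Fin.cons_zero,
        Fin.castSucc_zero, Fin.tail]
      simp only [h2, mul_assoc]
      congr 4
      funext i
      refine Fin.cases rfl (fun i => rfl) i

open Classical in
theorem latticePartitionFunction_eq_latticeRec {N r : ℕ} (v : Fin r → ℕ → ℕ → R) (a : Fin N → ℕ)
    (right : Set (Fin r → ℕ)) :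
    latticePartitionFunction (fun i _ => vertexWeight (v i)) a (fun _ => 0) (fun _ => 0) right =
      latticeRec r v a fun m => if m ∈ right then 1 else 0 := by
  rw [← finsum_latticeConfigurations, latticePartitionFunction, finsum_mem_def, finsum_mem_def]
  refine finsum_congr fun s => ?_
  by_cases h1 : s.1 0 = a <;> by_cases h2 : s.1 (Fin.last r) = 0 <;>
    by_cases h3 : (fun i => s.2 i 0) = fun _ => 0 <;>
    by_cases h4 : (fun i => s.2 i (Fin.last N)) ∈ right <;>
    simp [Set.indicator, h1, h2, h3, h4, ← Pi.zero_def]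

theorem rowOp_zero_fun (w : ℕ → ℕ → R) {N : ℕ} (a : Fin N → ℕ) (b : ℕ) :
    rowOp w N a b (fun _ _ => 0) = 0 := by
  simpa using rowOp_mul w 0 a b fun _ _ => 0

theorem latticeRec_cons_zero {N r : ℕ} (v : Fin r → ℕ → ℕ → R) (hv : ∀ i, v i 0 0 = 1)
    (a : Fin N → ℕ) (g : (Fin r → ℕ) → R) :
    latticeRec r v (Fin.cons 0 a : Fin (N + 1) → ℕ) g = latticeRec r v a g := by
  induction r generalizing a with
  | zero =>
    have : (Fin.cons 0 a : Fin (N + 1) → ℕ) = 0 ↔ a = 0 := by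
      rw [← Fin.cons_self_tail (0 : Fin (N + 1) → ℕ), Fin.cons_inj]
      simp; rfl
    simp only [latticeRec, this]
  | succ r ih =>
    simp [latticeRec, rowOp, hv, Fin.tail_cons, ih (Fin.tail v) fun i => hv i.succ]

/-- Because a top label is at least the left label, particles leaving a column all to the right make
the next column nonempty. The leftmost nonempty column thus moves by at most one step per row, and
`r ≤ N` rows cannot empty `N + 1` columns. -/
theorem latticeRec_eq_zero {N r : ℕ} (hr : r ≤ N) (v : Fin r → ℕ → ℕ → R)
    (hv : ∀ i, v i 0 0 = 1) (a : Fin (N + 1) → ℕ) (ha : a 0 ≠ 0) (g : (Fin r → ℕ) → R) :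
    latticeRec r v a g = 0 := by
  induction r generalizing N with
  | zero => exact if_neg fun h => ha (congrFun h 0)
  | succ r ih =>
    obtain ⟨N, rfl⟩ := Nat.exists_eq_succ_of_ne_zero (show N ≠ 0 by omega)
    rw [latticeRec, rowOp]
    refine Finset.sum_eq_zero fun k _ => ?_
    rcases Nat.eq_zero_or_pos k with rfl | hk
    · simp only [add_zero, latticeRec_cons_zero (Fin.tail v) fun i => hv i.succ, rowOp]
      rw [Finset.sum_eq_zero, mul_zero]
      intro k _
      rw [show (fun (c : Fin N → ℕ) d => latticeRec r (Fin.tail v)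
        (Fin.cons (a 0 - 0 + k) c : Fin (N + 1) → ℕ) fun m => g (Fin.cons d m)) = fun _ _ => 0 from
          funext fun c => funext fun d => ih (by omega) _ (fun i => hv i.succ) _ (by simp; omega) _,
        rowOp_zero_fun, mul_zero]
    · rw [show (fun (c : Fin (N + 1) → ℕ) d => latticeRec r (Fin.tail v)
        (Fin.cons (0 + k) c : Fin (N + 1 + 1) → ℕ) fun m => g (Fin.cons d m)) = fun _ _ => 0 from
          funext fun c => funext fun d => ih (by omega) _ (fun i => hv i.succ) _ (by simp; omega) _,
        rowOp_zero_fun, mul_zero]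

/-- The first column must be emptied by the bottom row, after which it is inert; this yields the
triangular shape. The factor `v 0 (a 0) 0` is `1` for expansion vertices and `x ^ a 0` for Whittaker
ones. -/
theorem latticeRec_square {r : ℕ} (v : Fin (r + 1) → ℕ → ℕ → R) (hv : ∀ i, v i 0 0 = 1)
    (a : Fin (r + 1) → ℕ) (g : (Fin (r + 1) → ℕ) → R) :
    latticeRec (r + 1) v a g = v 0 (a 0) 0 * rowOp (v 0) r (Fin.tail a) (a 0) fun c d =>
      latticeRec r (Fin.tail v) c fun m => g (Fin.cons d m) := by
  rw [latticeRec, rowOp, Finset.sum_eq_single 0]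
  · simp only [add_zero, latticeRec_cons_zero (Fin.tail v) fun i => hv i.succ, Nat.sub_zero]
  · intro k _ hk
    rw [show (fun (c : Fin r → ℕ) d => latticeRec r (Fin.tail v)
      (Fin.cons (0 + k) c : Fin (r + 1) → ℕ) fun m => g (Fin.cons d m)) = fun _ _ => 0 from
        funext fun c => funext fun d =>
          latticeRec_eq_zero le_rfl _ (fun i => hv i.succ) _ (by simp; omega) _,
      rowOp_zero_fun, mul_zero]
  · simp

theorem latticeRec_expansionVertex (q : R) {n : ℕ} (a : Fin n → ℕ) (g : (Fin n → ℕ) → R) :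
    latticeRec n (fun _ => expansionVertex q) a g = triangleOp q n a g := by
  induction n with
  | zero =>
    rw [latticeRec, if_pos (Subsingleton.elim _ _), triangleOp]
    congr 1
    exact Subsingleton.elim _ _
  | succ n ih =>
    rw [latticeRec_square _ fun _ => by simp [expansionVertex, qBinom], triangleOp]
    simp only [Fin.tail_def, ih]
    simp [expansionVertex, qBinom_zero_right]

theorem latticeRec_whittakerVertex (q : R) {n : ℕ} (x : Fin n → R) (a : Fin n → ℕ) :
    latticeRec n (fun i => whittakerVertex q 1 (x i.rev)) a (fun _ => 1) = inhomRec q n x a := by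
  induction n with
  | zero => rw [latticeRec, if_pos (Subsingleton.elim _ _), inhomRec]
  | succ n ih =>
    rw [latticeRec_square _ fun _ => by simp [whittakerVertex, qBinom, qPochhammer_zero_right],
      inhomRec]
    simp only [Fin.tail_def, Fin.rev_succ, ih fun i => x i.castSucc, Fin.rev_zero]
    simp [whittakerVertex, qBinom_zero_right, qPochhammer_zero_right]

/-- Indexing by `j.rev` places the extra empty columns on the left, where no particle enters them.
-/
theorem latticeRec_append_zero {N r : ℕ} (v : Fin r → ℕ → ℕ → R) (hv : ∀ i, v i 0 0 = 1)
    (m : ℕ → ℕ) (hm : ∀ i, N ≤ i → m i = 0) {M : ℕ} (hM : N ≤ M) (g : (Fin r → ℕ) → R) :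
    latticeRec r v (fun j : Fin M => m j.rev) g = latticeRec r v (fun j : Fin N => m j.rev) g := by
  induction M, hM using Nat.le_induction with
  | base => rfl
  | succ M hM ih =>
    rw [← ih, ← latticeRec_cons_zero v hv fun j : Fin M => m j.rev]
    congr 1
    funext j
    refine Fin.cases ?_ (fun j => ?_) j
    · simpa using hm M hM
    · simp [Fin.rev_succ]

end Lattice

/-! ### Partitions in terms of column multiplicities -/

namespace YoungDiagram

theorem ext_rowLen {mu nu : YoungDiagram} (h : ∀ i, mu.rowLen i = nu.rowLen i) : mu = nu := by
  refine YoungDiagram.ext (Finset.ext ?_)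
  rintro ⟨i, j⟩
  rw [mem_cells, mem_cells, mem_iff_lt_rowLen, mem_iff_lt_rowLen, h]

theorem colLen_zero_le_iff {mu : YoungDiagram} {n : ℕ} : mu.colLen 0 ≤ n ↔ mu.rowLen n = 0 := by
  rw [← not_lt, ← mem_iff_lt_colLen, mem_iff_lt_rowLen, not_lt, Nat.le_zero]

theorem rowLen_eq_zero {mu : YoungDiagram} {n i : ℕ} (h : mu.colLen 0 ≤ n) (hi : n ≤ i) :
    mu.rowLen i = 0 :=
  colLen_zero_le_iff.1 (h.trans hi)

theorem colMult_succ (mu : YoungDiagram) (i : ℕ) :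
    mu.colMult (i + 1) = mu.rowLen i - mu.rowLen (i + 1) := by
  rw [colMult, rowLens, colLen_transpose, List.count, List.countP_map, List.countP_eq_length_filter,
    ← List.toFinset_card_of_nodup (List.nodup_range.filter _), ← Nat.card_Ico]
  congr 1
  ext j
  have h1 := mem_iff_lt_rowLen (μ := mu) (i := i) (j := j)
  have h2 := mem_iff_lt_rowLen (μ := mu) (i := i + 1) (j := j)
  rw [mem_iff_lt_colLen] at h1 h2
  have h3 := mu.rowLen_anti 0 i (Nat.zero_le i)
  simp only [List.mem_toFinset, List.mem_filter, List.mem_range, Function.comp_apply,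
    rowLen_transpose, beq_iff_eq, Finset.mem_Ico]
  omega

/-- The Young diagram with given row lengths. -/
def ofAntitone (g : ℕ → ℕ) (hg : Antitone g) (n : ℕ) : YoungDiagram where
  cells := (Finset.range n ×ˢ Finset.range (g 0)).filter fun c => c.2 < g c.1
  isLowerSet := by
    rintro ⟨i, j⟩ ⟨i', j'⟩ ⟨h1, h2⟩ h
    simp only [Finset.coe_filter, Finset.mem_product, Finset.mem_range, Set.mem_ofPred_eq] at h h1 h2 ⊢
    have h3 := hg h1
    omega

theorem rowLen_ofAntitone (g : ℕ → ℕ) (hg : Antitone g) (n : ℕ) (hn : g n = 0) (i : ℕ) :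
    (ofAntitone g hg n).rowLen i = g i := by
  refine eq_of_forall_lt_iff fun j => ?_
  rw [← mem_iff_lt_rowLen, ← mem_cells]
  simp only [ofAntitone, Finset.mem_filter, Finset.mem_product, Finset.mem_range]
  refine ⟨fun h => h.2, fun h => ⟨⟨?_, h.trans_le (hg (Nat.zero_le i))⟩, h⟩⟩
  by_contra hi
  have := hg (not_lt.1 hi)
  omega

theorem card_eq_sum_rowLen {mu : YoungDiagram} {n : ℕ} (h : mu.colLen 0 ≤ n) :
    mu.card = ∑ i ∈ Finset.range n, mu.rowLen i := by
  rw [YoungDiagram.card, Finset.card_eq_sum_card_fiberwise (f := Prod.fst) (t := Finset.range n)]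
  · refine Finset.sum_congr rfl fun i _ => ?_
    rw [rowLen_eq_card]; rfl
  · rintro ⟨i, j⟩ hc
    have h1 := mem_iff_lt_rowLen.1 ((mem_cells _).1 hc)
    by_contra hi
    rw [rowLen_eq_zero h (by simpa using hi)] at h1
    omega

/-- The multiplicities of the columns of lengths `1, …, n`. -/
def colMults (n : ℕ) (mu : YoungDiagram) : Fin n → ℕ := fun i => mu.colMult (i + 1)

theorem colMults_apply (n : ℕ) (mu : YoungDiagram) (i : Fin n) :
    mu.colMults n i = mu.rowLen i - mu.rowLen (i + 1) := colMult_succ mu i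

theorem card_eq_sum_colMults {mu : YoungDiagram} {n : ℕ} (h : mu.colLen 0 ≤ n) :
    mu.card = ∑ i : Fin n, ((i : ℕ) + 1) * mu.colMults n i := by
  simp only [colMults_apply]
  rw [card_eq_sum_rowLen h,
    Fin.sum_univ_eq_sum_range (fun i => (i + 1) * (mu.rowLen i - mu.rowLen (i + 1))) n]
  -- Abel summation; the boundary term `k * mu.rowLen k` vanishes at `k = n`.
  have key : ∀ k, ∑ i ∈ Finset.range k, mu.rowLen i =
      ∑ i ∈ Finset.range k, (i + 1) * (mu.rowLen i - mu.rowLen (i + 1)) + k * mu.rowLen k := by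
    intro k
    induction k with
    | zero => simp
    | succ k ih =>
      rw [Finset.sum_range_succ, Finset.sum_range_succ, ih]
      obtain ⟨d, hd⟩ := Nat.exists_eq_add_of_le' (mu.rowLen_anti k (k + 1) (by omega))
      rw [hd, Nat.add_sub_cancel]
      ring
  rw [key, rowLen_eq_zero h le_rfl, mul_zero, add_zero]

theorem bijOn_colMults (n : ℕ) :
    Set.BijOn (colMults n) {mu : YoungDiagram | mu.colLen 0 ≤ n} Set.univ := by
  refine ⟨fun _ _ => trivial, fun mu hmu nu hnu h => ext_rowLen fun i => ?_, fun m _ => ?_⟩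
  · rw [Set.mem_ofPred_eq] at hmu hnu
    rcases le_total n i with hi | hi
    · rw [rowLen_eq_zero hmu hi, rowLen_eq_zero hnu hi]
    · induction hi using Nat.decreasingInduction with
      | self => rw [rowLen_eq_zero hmu le_rfl, rowLen_eq_zero hnu le_rfl]
      | of_succ i hi ih =>
        have h1 := congrFun h ⟨i, hi⟩
        simp only [colMults_apply] at h1
        have h2 := mu.rowLen_anti i (i + 1) (by omega)
        have h3 := nu.rowLen_anti i (i + 1) (by omega)
        omega
  · have hg : ∀ i : ℕ, (∑ j : Fin n, if i ≤ (j : ℕ) then m j else 0) =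
        (if h : i < n then m ⟨i, h⟩ else 0) + ∑ j : Fin n, if i + 1 ≤ (j : ℕ) then m j else 0 := by
      intro i
      split_ifs with h
      · rw [← Finset.add_sum_erase _ _ (Finset.mem_univ ⟨i, h⟩),
          ← Finset.add_sum_erase (a := ⟨i, h⟩) _ (fun j : Fin n => if i + 1 ≤ (j : ℕ) then m j else 0)
            (Finset.mem_univ _)]
        simp only [le_refl, if_true, Nat.not_succ_le_self, if_false, zero_add, Nat.add_one_le_iff]
        congr 1
        refine Finset.sum_congr rfl fun j hj => ?_
        have hj' : (j : ℕ) ≠ i := fun h' => (Finset.mem_erase.1 hj).1 (Fin.ext h')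
        exact if_congr (by omega) rfl rfl
      · rw [zero_add]
        refine Finset.sum_congr rfl fun j _ => ?_
        rw [if_neg (by omega), if_neg (by omega)]
    have hn : (∑ j : Fin n, if n ≤ (j : ℕ) then m j else 0) = 0 :=
      Finset.sum_eq_zero fun j _ => if_neg (by omega)
    -- Row `i` meets exactly the columns longer than `i`, so its length is a tail sum of the
    -- multiplicities.
    refine ⟨ofAntitone (fun i => ∑ j : Fin n, if i ≤ (j : ℕ) then m j else 0)
      (antitone_nat_of_succ_le fun i => by rw [hg i]; omega) n, ?_, funext fun i => ?_⟩
    · rw [Set.mem_ofPred_eq, colLen_zero_le_iff, rowLen_ofAntitone _ _ n hn, hn]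
    · rw [colMults_apply, rowLen_ofAntitone _ _ n hn, rowLen_ofAntitone _ _ n hn, hg i, dif_pos i.2,
        Nat.add_sub_cancel]

end YoungDiagram

/-! ### The branching operator in closed form -/

section Branching

variable {R : Type*} [CommRing R]

theorem sum_piFinset_succ {M : Type*} [AddCommMonoid M] {n : ℕ} (s : Fin (n + 1) → Finset ℕ)
    (f : (Fin (n + 1) → ℕ) → M) :
    ∑ k ∈ Fintype.piFinset s, f k =
      ∑ k ∈ Fintype.piFinset (Fin.tail s), ∑ k₀ ∈ s 0, f (Fin.cons k₀ k) := by
  rw [← Finset.sum_product']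
  refine Finset.sum_nbij' (fun k => (Fin.tail k, k 0)) (fun p => Fin.cons p.2 p.1) ?_ ?_ ?_ ?_ ?_
  · intro k hk
    rw [Fin.mem_piFinset_iff_zero_tail] at hk
    exact Finset.mem_product.2 hk.symm
  · intro p hp
    rw [Fin.mem_piFinset_iff_zero_tail]
    exact (Finset.mem_product.1 hp).symm
  · intro k _; simp
  · intro p _; simp
  · intro k _; simp

/-- Here `k i` counts the columns of length `i + 1` that keep their length, while the others lose a
box. All columns of the maximal length `n + 1` lose one, hence the final `0` in `Fin.snoc k 0`. -/
theorem branchOp_eq_sum (q x : R) {n : ℕ} (m : Fin (n + 1) → ℕ) (f : (Fin n → ℕ) → ℕ → R) :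
    branchOp q x n m f = ∑ k ∈ Fintype.piFinset fun i : Fin n => Finset.range (m i.castSucc + 1),
      (∏ i, whittakerVertex q 0 x (m i.castSucc) (k i)) * x ^ m (Fin.last n) *
        f (fun i => m i.succ - (Fin.snoc k 0 : Fin (n + 1) → ℕ) i.succ + k i)
          (m 0 - (Fin.snoc k 0 : Fin (n + 1) → ℕ) 0) := by
  induction n with
  | zero =>
    simp [branchOp, Fin.tail_def]
    congr 2
    exact Subsingleton.elim _ _
  | succ n ih =>
    rw [branchOp, ih, sum_piFinset_succ]
    refine Finset.sum_congr rfl fun k _ => ?_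
    rw [Finset.mul_sum]
    refine Finset.sum_congr rfl fun k₀ _ => ?_
    rw [Fin.prod_univ_succ]
    simp only [← Fin.cons_snoc_eq_snoc_cons, Fin.cons_zero, Fin.cons_succ, Fin.tail, Fin.castSucc_zero,
      Fin.succ_last, Fin.succ_castSucc]
    rw [show (Fin.cons (m (Fin.succ 0) - (Fin.snoc k 0 : Fin (n + 1) → ℕ) 0 + k₀) fun i : Fin n =>
        m i.succ.succ - (Fin.snoc k 0 : Fin (n + 1) → ℕ) i.succ + k i : Fin (n + 1) → ℕ) =
        fun i => m i.succ - (Fin.snoc k 0 : Fin (n + 1) → ℕ) i + (Fin.cons k₀ k : Fin (n + 1) → ℕ) i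
      from funext fun i => Fin.cases rfl (fun _ => rfl) i]
    ring

end Branching

/-! ### The branching rule of the `q`-Whittaker polynomials -/

section QWhittaker

open YoungDiagram

theorem qWhittaker_eq_zero {n : ℕ} {lam : YoungDiagram} (h : n < lam.colLen 0) :
    qWhittaker n lam = 0 := by
  induction n generalizing lam with
  | zero =>
    rw [qWhittaker, if_neg]
    rintro rfl
    rw [← mem_iff_lt_colLen] at h
    exact notMem_bot _ h
  | succ n ih =>
    rw [qWhittaker]
    refine finsum_mem_eq_zero_of_forall_eq_zero fun mu hmu => ?_
    rw [ih, map_zero, mul_zero]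
    rw [← mem_iff_lt_colLen, mem_iff_lt_rowLen] at h ⊢
    exact h.trans_le (hmu n).2

/-- The coordinates `μ_i - λ_(i+1)` turn the interlacing conditions into a box with sides `λ_i -
λ_(i+1)`. Diagrams `μ` with more than `n` rows are removed by `hF`, as `W_μ` vanishes on them. -/
theorem finsum_mem_interlacing {M : Type*} [AddCommMonoid M] {n : ℕ} {lam : YoungDiagram}
    (hlam : lam.colLen 0 ≤ n + 1) (F : YoungDiagram → M) (G : (Fin n → ℕ) → M)
    (hF : ∀ mu : YoungDiagram, n < mu.colLen 0 → F mu = 0)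
    (hFG : ∀ mu : YoungDiagram, mu.colLen 0 ≤ n →
      (∀ i, mu.rowLen i ≤ lam.rowLen i ∧ lam.rowLen (i + 1) ≤ mu.rowLen i) →
        F mu = G fun i => mu.rowLen i - lam.rowLen (i + 1)) :
    ∑ᶠ mu ∈ {mu : YoungDiagram |
        ∀ i, mu.rowLen i ≤ lam.rowLen i ∧ lam.rowLen (i + 1) ≤ mu.rowLen i}, F mu =
      ∑ k ∈ Fintype.piFinset fun i : Fin n =>
        Finset.range (lam.colMults (n + 1) i.castSucc + 1), G k := by
  rw [← finsum_mem_coe_finset]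
  trans ∑ᶠ mu ∈ {mu : YoungDiagram | mu.colLen 0 ≤ n ∧
    ∀ i, mu.rowLen i ≤ lam.rowLen i ∧ lam.rowLen (i + 1) ≤ mu.rowLen i}, F mu
  · refine finsum_mem_inter_support_eq' F _ _ fun mu hmu => ⟨fun h => ⟨?_, h⟩, fun h => h.2⟩
    by_contra h'
    exact hmu (hF mu (not_le.1 h'))
  · refine finsum_mem_eq_of_bijOn (fun mu i => mu.rowLen i - lam.rowLen (i + 1)) ⟨?_, ?_, ?_⟩
      fun mu hmu => hFG mu hmu.1 hmu.2
    · rintro mu ⟨-, h⟩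
      simp only [Finset.mem_coe, Fintype.mem_piFinset, Finset.mem_range, colMults_apply,
        Fin.val_castSucc]
      intro i
      have := (h i).1
      omega
    · rintro mu ⟨hmu, h⟩ nu ⟨hnu, h'⟩ heq
      refine ext_rowLen fun i => ?_
      rcases le_or_gt n i with hi | hi
      · rw [rowLen_eq_zero hmu hi, rowLen_eq_zero hnu hi]
      · have h1 := congrFun heq ⟨i, hi⟩
        have h2 := (h i).2
        have h3 := (h' i).2
        dsimp only at h1
        omega
    · intro k hk
      simp only [Finset.mem_coe, Fintype.mem_piFinset, Finset.mem_range, colMults_apply,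
        Fin.val_castSucc] at hk
      have hanti : Antitone fun i => if h : i < n then lam.rowLen (i + 1) + k ⟨i, h⟩ else 0 := by
        refine antitone_nat_of_succ_le fun i => ?_
        split_ifs with h1 h2
        · have h3 := hk ⟨i + 1, h1⟩
          have h4 := lam.rowLen_anti (i + 1) (i + 1 + 1) (by omega)
          dsimp only at h3
          omega
        all_goals omega
      have hn : (fun i => if h : i < n then lam.rowLen (i + 1) + k ⟨i, h⟩ else 0) n = 0 :=
        dif_neg (lt_irrefl n)
      refine ⟨ofAntitone _ hanti n, ⟨?_, fun i => ?_⟩, funext fun i => ?_⟩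
      · rw [colLen_zero_le_iff, rowLen_ofAntitone _ _ n hn]
        exact hn
      · rw [rowLen_ofAntitone _ _ n hn]
        split_ifs with h1
        · have h3 := hk ⟨i, h1⟩
          have h4 := lam.rowLen_anti i (i + 1) (by omega)
          dsimp only at h3
          omega
        · have := rowLen_eq_zero hlam (show n + 1 ≤ i + 1 by omega)
          omega
      · dsimp only
        rw [rowLen_ofAntitone _ _ n hn, dif_pos i.2, Nat.add_sub_cancel_left]

theorem map_branchOp {R S : Type*} [CommRing R] [CommRing S] (φ : R →+* S) (q x : R) {n : ℕ}
    (m : Fin (n + 1) → ℕ) (f : (Fin n → ℕ) → ℕ → R) :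
    φ (branchOp q x n m f) = branchOp (φ q) (φ x) n m fun c d => φ (f c d) := by
  simp [branchOp_eq_sum, map_sum, map_prod, whittakerVertex, map_qBinom, map_qPochhammer]

theorem map_whittakerRec {R S : Type*} [CommRing R] [CommRing S] (φ : R →+* S) (q : R) {n : ℕ}
    (x : Fin n → R) (m : Fin n → ℕ) :
    φ (whittakerRec q n x m) = whittakerRec (φ q) n (fun i => φ (x i)) m := by
  induction n with
  | zero => simp [whittakerRec]
  | succ n ih => simp only [whittakerRec, map_branchOp, ih]

theorem qWhittaker_eq_whittakerRec {n : ℕ} {lam : YoungDiagram} (hlam : lam.colLen 0 ≤ n) :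
    qWhittaker n lam =
      whittakerRec (MvPolynomial.C Polynomial.X) n MvPolynomial.X (lam.colMults n) := by
  induction n generalizing lam with
  | zero =>
    rw [qWhittaker, if_pos, whittakerRec]
    refine ext_rowLen fun i => ?_
    rw [rowLen_eq_zero hlam (Nat.zero_le i), eq_comm, ← Nat.le_zero, ← not_lt, ← mem_iff_lt_rowLen]
    exact notMem_bot _
  | succ n ih =>
    rw [qWhittaker, finsum_mem_interlacing hlam _ (fun k =>
        (∏ i : Fin n, whittakerVertex (MvPolynomial.C Polynomial.X) 0 (MvPolynomial.X (Fin.last n))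
          (lam.colMults (n + 1) i.castSucc) (k i)) *
        MvPolynomial.X (Fin.last n) ^ lam.colMults (n + 1) (Fin.last n) *
        whittakerRec (MvPolynomial.C Polynomial.X) n (fun i => MvPolynomial.X i.castSucc)
          (fun i => lam.colMults (n + 1) i.succ - (Fin.snoc k 0 : Fin (n + 1) → ℕ) i.succ + k i)),
      whittakerRec, branchOp_eq_sum]
    · intro mu hmu
      rw [qWhittaker_eq_zero hmu, map_zero, mul_zero]
    · intro mu hmu h
      rw [ih hmu]
      congr 1
      · have hk : ∀ i : Fin n, lam.colMults (n + 1) i.castSucc - (mu.rowLen i - lam.rowLen (i + 1)) =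
            lam.rowLen i - mu.rowLen i := fun i => by
          rw [colMults_apply, Fin.val_castSucc]
          have := h i
          omega
        have hlast : lam.colMults (n + 1) (Fin.last n) = lam.rowLen n := by
          rw [colMults_apply, Fin.val_last, rowLen_eq_zero hlam le_rfl, Nat.sub_zero]
        have hcard : lam.card - mu.card = ∑ i : Fin n, (lam.rowLen i - mu.rowLen i) +
            lam.rowLen n := by
          rw [card_eq_sum_rowLen hlam, card_eq_sum_rowLen hmu, Finset.sum_range_succ,
            Fin.sum_univ_eq_sum_range (fun i => lam.rowLen i - mu.rowLen i) n,
            Finset.sum_tsub_distrib _ fun i _ => (h i).1]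
          have := Finset.sum_le_sum fun i (_ : i ∈ Finset.range n) => (h i).1
          omega
        have hprod : ∏ i ∈ Finset.range (lam.colLen 0), qBinom (Polynomial.X : Polynomial ℤ)
            (lam.rowLen i - lam.rowLen (i + 1)) (lam.rowLen i - mu.rowLen i) =
            ∏ i : Fin n, qBinom (Polynomial.X : Polynomial ℤ) (lam.colMults (n + 1) i.castSucc)
              (mu.rowLen i - lam.rowLen (i + 1)) := by
          rw [Finset.prod_subset (Finset.range_subset_range.2 hlam), Finset.prod_range_succ,
            rowLen_eq_zero hlam le_rfl, rowLen_eq_zero hmu le_rfl, qBinom_self, mul_one,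
            ← Fin.prod_univ_eq_prod_range]
          · refine Finset.prod_congr rfl fun i _ => ?_
            have h1 := h i
            obtain ⟨k, hk'⟩ := Nat.exists_eq_add_of_le h1.1
            obtain ⟨t, ht⟩ := Nat.exists_eq_add_of_le h1.2
            -- The branching rule selects `λ_i - μ_i` and the operator selects `μ_i - λ_(i+1)`; the
            -- two binomials agree by symmetry.
            rw [colMults_apply, Fin.val_castSucc,
              show lam.rowLen i - lam.rowLen (i + 1) = k + t by omega,
              show lam.rowLen i - mu.rowLen i = k by omega,
              show mu.rowLen i - lam.rowLen (i + 1) = t by omega, qBinom_symm_add]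
          · intro i _ hi
            rw [rowLen_eq_zero le_rfl (by simpa using hi), Nat.zero_sub, Nat.zero_sub, qBinom_self]
        simp only [hlast, hcard, hprod, whittakerVertex, hk, zero_mul, qPochhammer_zero_left, mul_one,
          Finset.prod_mul_distrib, Finset.prod_pow_eq_pow_sum, map_prod, map_qBinom, pow_add]
        ring
      · rw [← AlgHom.coe_toRingHom, map_whittakerRec]
        simp only [AlgHom.coe_toRingHom, MvPolynomial.rename_X, MvPolynomial.rename_C]
        congr 1
        funext i
        have hs : ∀ j : Fin (n + 1), (Fin.snoc (fun i : Fin n => mu.rowLen i - lam.rowLen (i + 1)) 0 :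
            Fin (n + 1) → ℕ) j = mu.rowLen j - lam.rowLen (j + 1) := by
          intro j
          induction j using Fin.lastCases with
          | last => rw [Fin.snoc_last, Fin.val_last, rowLen_eq_zero hmu le_rfl, Nat.zero_sub]
          | cast j => rw [Fin.snoc_castSucc]; rfl
        rw [hs, colMults_apply, colMults_apply, Fin.val_succ]
        have h1 := h i
        have h2 := h (i + 1)
        omega

end QWhittaker

/-! ### Particle conservation and signs -/

section Triangle

theorem map_rowOp {R S : Type*} [CommRing R] [CommRing S] (φ : R →+* S) (w : ℕ → ℕ → R) {N : ℕ}
    (a : Fin N → ℕ) (b : ℕ) (f : (Fin N → ℕ) → ℕ → R) :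
    φ (rowOp w N a b f) = rowOp (fun a k => φ (w a k)) N a b fun c d => φ (f c d) := by
  induction N generalizing b with
  | zero => rfl
  | succ N ih => simp only [rowOp, map_sum, map_mul, ih]

theorem map_triangleOp {R S : Type*} [CommRing R] [CommRing S] (φ : R →+* S) (q : R) {n : ℕ}
    (a : Fin n → ℕ) (f : (Fin n → ℕ) → R) :
    φ (triangleOp q n a f) = triangleOp (φ q) n a fun m => φ (f m) := by
  induction n with
  | zero => rfl
  | succ n ih =>
    simp only [triangleOp, map_rowOp, ih, expansionVertex, map_mul, map_pow, map_neg, map_one,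
      map_qBinom]
    rfl

variable {R : Type*} [CommRing R]

theorem rowOp_congr (w : ℕ → ℕ → R) {N : ℕ} (a : Fin N → ℕ) (b : ℕ)
    {f g : (Fin N → ℕ) → ℕ → R} (h : ∀ c d, ∑ j, c j + d = ∑ j, a j + b → f c d = g c d) :
    rowOp w N a b f = rowOp w N a b g := by
  induction N generalizing b with
  | zero => exact h a b rfl
  | succ N ih =>
    refine Finset.sum_congr rfl fun k hk => ?_
    congr 1
    refine ih _ _ fun c d hcd => h _ _ ?_
    rw [Finset.mem_range] at hk
    rw [Fin.sum_univ_succ, Fin.sum_univ_succ]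
    simp only [Fin.cons_zero, Fin.cons_succ, Fin.tail] at hcd ⊢
    omega

theorem triangleOp_congr (q : R) {n : ℕ} (a : Fin n → ℕ) {f g : (Fin n → ℕ) → R}
    (h : ∀ m, ∑ j, m j = ∑ j, a j → f m = g m) : triangleOp q n a f = triangleOp q n a g := by
  induction n with
  | zero => exact h a rfl
  | succ n ih =>
    refine rowOp_congr _ _ _ fun c d hcd => ih _ fun m hm => h _ ?_
    rw [Fin.sum_univ_succ, Fin.sum_univ_succ]
    simp only [Fin.cons_zero, Fin.cons_succ, Fin.tail] at hcd ⊢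
    omega

/-- By conservation only output labels with the same sum as `a` matter, so `f` can be replaced by a
finite combination of indicator functions. -/
theorem triangleOp_eq_sum (q : R) {n : ℕ} (a : Fin n → ℕ) (f : (Fin n → ℕ) → R) :
    triangleOp q n a f = ∑ s ∈ Finset.Nat.antidiagonalTuple n (∑ j, a j),
      f s * triangleOp q n a fun m => if m = s then 1 else 0 := by
  rw [← triangleOp_sum_mul]
  refine triangleOp_congr q a fun m hm => ?_
  simp [Finset.Nat.mem_antidiagonalTuple, hm]

theorem triangleOp_single_eq_zero (q : R) {n : ℕ} (a s : Fin n → ℕ) (h : ∑ j, s j ≠ ∑ j, a j) :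
    triangleOp q n a (fun m => if m = s then 1 else 0) = 0 := by
  rw [triangleOp_eq_sum]
  refine Finset.sum_eq_zero fun t ht => ?_
  rw [if_neg, zero_mul]
  rintro rfl
  exact h (Finset.Nat.mem_antidiagonalTuple.1 ht)

/-- The integer polynomials with nonnegative coefficients. -/
noncomputable def nonnegPolynomials : Subsemiring (Polynomial ℤ) :=
  (Polynomial.mapRingHom (Nat.castRingHom ℤ)).rangeS

theorem X_mem_nonnegPolynomials : Polynomial.X ∈ nonnegPolynomials :=
  ⟨Polynomial.X, by simp⟩

theorem qBinom_mem_nonnegPolynomials (n k : ℕ) :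
    qBinom Polynomial.X n k ∈ nonnegPolynomials := by
  induction n generalizing k with
  | zero => cases k <;> simp [qBinom, one_mem, zero_mem]
  | succ n ih =>
    cases k with
    | zero => simp [qBinom, one_mem]
    | succ k => exact add_mem (ih k) (mul_mem (pow_mem X_mem_nonnegPolynomials _) (ih _))

/-- At each vertex the left and top edges have a height one greater than the bottom and right edges.
By conservation the weighted label total grows by `c - b`, which cancels the sign of the weight. The
offset `e` records edges outside the row, and `s` the height of the row. -/
theorem neg_one_pow_mul_rowOp_mem (s : ℕ) {N : ℕ} (e : ℕ) (a : Fin N → ℕ) (b : ℕ)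
    (f : (Fin N → ℕ) → ℕ → Polynomial ℤ)
    (h : ∀ c d, (-1) ^ (e + (s + 1) * d + ∑ j, ((j.rev : ℕ) + 2 + s) * c j) * f c d ∈
      nonnegPolynomials) :
    (-1) ^ (e + (N + s + 1) * b + ∑ j, ((j.rev : ℕ) + 1 + s) * a j) *
      rowOp (expansionVertex Polynomial.X) N a b f ∈ nonnegPolynomials := by
  induction N generalizing e b with
  | zero => simpa [rowOp] using h a b
  | succ N ih =>
    rw [rowOp, Finset.mul_sum]
    refine sum_mem fun k hk => ?_
    obtain ⟨t, ht⟩ := Nat.exists_eq_add_of_le' (Nat.lt_succ_iff.1 (Finset.mem_range.1 hk))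
    -- The top label `b + k` of the first column, at height `N + 2 + s`, is now fixed and moves into
    -- the offset.
    have h1 := ih (e + (N + 2 + s) * (b + k)) (Fin.tail a) (a 0 - k)
      (fun c d => f (Fin.cons (b + k) c) d) fun c d => by
        have h2 := h (Fin.cons (b + k) c) d
        rw [Fin.sum_univ_succ] at h2
        simp only [Fin.cons_zero, Fin.cons_succ, Fin.rev_zero, Fin.val_last, Fin.rev_succ,
          Fin.val_castSucc] at h2
        convert h2 using 3
        ring
    have h3 := mul_mem (mul_mem (pow_mem X_mem_nonnegPolynomials (k.choose 2))
      (qBinom_mem_nonnegPolynomials (a 0) k)) h1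
    convert h3 using 1
    rw [Fin.sum_univ_succ, expansionVertex]
    simp only [Fin.rev_zero, Fin.val_last, Fin.rev_succ, Fin.val_castSucc, Fin.tail]
    rw [ht, Nat.add_sub_cancel]
    -- The surplus `k` is the gain at this vertex and matches its sign `(-1) ^ k`.
    rw [show e + (N + 2 + s) * (b + k) + (N + s + 1) * t = e + (N + 1 + s + 1) * b +
      (N + 1 + s) * (t + k) + k by ring]
    simp only [pow_add]
    ring

theorem neg_one_pow_mul_triangleOp_mem (s : ℕ) {n : ℕ} (e : ℕ) (a : Fin n → ℕ)
    (f : (Fin n → ℕ) → Polynomial ℤ)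
    (h : ∀ m, (-1) ^ (e + ∑ i : Fin n, ((i : ℕ) + 1 + s) * m i) * f m ∈ nonnegPolynomials) :
    (-1) ^ (e + ∑ j, ((j.rev : ℕ) + 1 + s) * a j) * triangleOp Polynomial.X n a f ∈
      nonnegPolynomials := by
  induction n generalizing e s with
  | zero => simpa [triangleOp] using h a
  | succ n ih =>
    rw [Fin.sum_univ_succ, triangleOp]
    have h1 := neg_one_pow_mul_rowOp_mem s e (Fin.tail a) (a 0)
      (fun c d => triangleOp Polynomial.X n c fun m => f (Fin.cons d m)) fun c d => by
        have h2 := ih (s + 1) (e + (s + 1) * d) c (fun m => f (Fin.cons d m)) fun m => by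
          have h3 := h (Fin.cons d m)
          rw [Fin.sum_univ_succ] at h3
          simp only [Fin.cons_zero, Fin.cons_succ, Fin.val_zero, Fin.val_succ] at h3
          convert h3 using 3
          rw [← add_assoc]
          congr 1
          · ring
          · exact Finset.sum_congr rfl fun _ _ => by ring
        convert h2 using 3
        congr 1
        exact Finset.sum_congr rfl fun _ _ => by ring
    convert h1 using 3
    simp only [Fin.rev_zero, Fin.val_last, Fin.rev_succ, Fin.val_castSucc, Fin.tail]
    ring

end Triangle

/-! ### The expansion and the main theorem -/

section Expansion

open YoungDiagram

theorem expansionCoeff_eq_triangleOp (n : ℕ) (lam mu : YoungDiagram) :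
    expansionCoeff n lam mu = triangleOp Polynomial.X n (fun j => lam.colMult ((j.rev : ℕ) + 1))
      fun m => if m = mu.colMults n then 1 else 0 := by
  rw [expansionCoeff, expansionWeight_eq_vertexWeight,
    latticePartitionFunction_eq_latticeRec (fun _ => expansionVertex Polynomial.X),
    latticeRec_expansionVertex]
  congr 1
  funext m
  by_cases h : m = mu.colMults n
  · rw [if_pos h, if_pos]
    exact Set.mem_singleton_iff.2 h
  · rw [if_neg h, if_neg]
    exact fun h' => h (Set.mem_singleton_iff.1 h')

theorem inhomQWhittaker_eq_inhomRec {n : ℕ} {lam : YoungDiagram} (hlam : lam.colLen 0 ≤ n) :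
    inhomQWhittaker n lam = inhomRec (MvPolynomial.C Polynomial.X) n MvPolynomial.X
      fun j => lam.colMult ((j.rev : ℕ) + 1) := by
  simp only [inhomQWhittaker, inhomWeight_eq_vertexWeight]
  rw [latticePartitionFunction_eq_latticeRec
      (fun i => whittakerVertex (MvPolynomial.C Polynomial.X) 1 (MvPolynomial.X i.rev)),
    ← latticeRec_append_zero _ _ (fun i => lam.colMult (i + 1)) _ hlam]
  · simp only [Set.mem_univ, if_true]
    exact latticeRec_whittakerVertex _ _ _
  · intro i
    simp [whittakerVertex, qBinom, qPochhammer_zero_right]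
  · intro i hi
    rw [colMult_succ, rowLen_eq_zero le_rfl hi, Nat.zero_sub]

end Expansion

theorem mainTheorem5 (n : ℕ) (lam : YoungDiagram) (hlam : lam.colLen 0 ≤ n) :
    {mu : YoungDiagram | mu.colLen 0 ≤ n ∧ expansionCoeff n lam mu ≠ 0}.Finite ∧
    inhomQWhittaker n lam =
      ∑ᶠ mu ∈ {mu : YoungDiagram | mu.colLen 0 ≤ n},
        MvPolynomial.C (expansionCoeff n lam mu) * qWhittaker n mu ∧
    ∀ mu : YoungDiagram, mu.colLen 0 ≤ n →
      ∃ p : Polynomial ℕ,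
        Polynomial.C (((-1 : ℤˣ) ^ ((lam.card : ℤ) - (mu.card : ℤ)) : ℤˣ) : ℤ) *
          expansionCoeff n lam mu = p.map (Nat.castRingHom ℤ) := by
  classical
  set a : Fin n → ℕ := fun j => lam.colMult ((j.rev : ℕ) + 1) with ha
  have hcoeff : ∀ mu, expansionCoeff n lam mu = triangleOp Polynomial.X n a
      fun m => if m = mu.colMults n then 1 else 0 := fun mu =>
    expansionCoeff_eq_triangleOp n lam mu
  have hbij := YoungDiagram.bijOn_colMults n
  refine ⟨?_, ?_, fun mu hmu => ?_⟩
  · refine Set.Finite.of_finite_image (f := YoungDiagram.colMults n)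
      ((Finset.Nat.antidiagonalTuple n (∑ j, a j)).finite_toSet.subset ?_)
      (hbij.injOn.mono fun mu h => h.1)
    rintro _ ⟨mu, ⟨-, h⟩, rfl⟩
    rw [Finset.mem_coe, Finset.Nat.mem_antidiagonalTuple]
    by_contra h'
    rw [hcoeff] at h
    exact h (triangleOp_single_eq_zero _ _ _ h')
  · rw [inhomQWhittaker_eq_inhomRec hlam, inhomRec_eq_triangleOp, triangleOp_eq_sum,
      finsum_mem_eq_of_bijOn (YoungDiagram.colMults n) hbij (g := fun m =>
        whittakerRec (MvPolynomial.C Polynomial.X) n MvPolynomial.X m *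
          triangleOp (MvPolynomial.C Polynomial.X) n a fun m' => if m' = m then 1 else 0),
      finsum_mem_univ, finsum_eq_sum_of_support_subset]
    · intro s hs
      rw [Finset.mem_coe, Finset.Nat.mem_antidiagonalTuple]
      by_contra h
      exact right_ne_zero_of_mul hs (triangleOp_single_eq_zero _ _ _ h)
    · intro mu hmu
      rw [hcoeff, qWhittaker_eq_whittakerRec hmu, map_triangleOp, mul_comm]
      simp only [apply_ite MvPolynomial.C, map_one, map_zero]
  -- With offset `|μ|`, the exponent is `|μ| + |μ|` on the indicated output and `|μ| + |λ|` on the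
  -- input.
  · have hsign := neg_one_pow_mul_triangleOp_mem 0 mu.card a
      (fun m => if m = mu.colMults n then 1 else 0) fun m => by
        split_ifs with h
        · rw [h, YoungDiagram.card_eq_sum_colMults hmu]
          simp only [add_zero, mul_one]
          rw [Even.neg_one_pow ⟨_, rfl⟩]
          exact one_mem _
        · rw [mul_zero]
          exact zero_mem _
    have hlam' : ∑ j : Fin n, ((j.rev : ℕ) + 1 + 0) * a j = lam.card := by
      rw [YoungDiagram.card_eq_sum_colMults hlam, ← Equiv.sum_comp Fin.revPerm]
      simp only [ha, Fin.revPerm_apply, Fin.rev_rev, add_zero]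
      rfl
    rw [hlam', ← hcoeff] at hsign
    obtain ⟨p, hp⟩ := hsign
    refine ⟨p, ?_⟩
    rw [Polynomial.coe_mapRingHom] at hp
    -- The integer exponent may be negative; units of `ℤ` are their own inverses, so the difference
    -- can be replaced by the sum.
    rw [hp, zpow_sub, Int.units_inv_eq_self, zpow_natCast, zpow_natCast]
    simp [pow_add, mul_comm]
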